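/- Let $K$ be a field. Paths in a quiver $Q$ are composed from right to left, $KQ$ denotes the path algebra, $i(p)$ and $t(p)$ the initial and terminal vertex of a path $p$, and modules are left modules. A noetherian semiperfect ring $A$ with Jacobson radical $J$ is called quasi-Koszul if its Yoneda algebra $E=\bigoplus_{i\ge 0}\mathrm{Ext}^i_A(A/J,A/J)$ is generated in degrees $0$ and $1$, i.e. $E_i=E_1^{\,i}$ for all $i\ge 2$. A graded $K$-algebra $A=\bigoplus_{i\ge0}A_i$ is called a graded quiver algebra if $A_0\cong K^r$ as $K$-algebras for some $r\ge 1$, $\dim_K A_i<\infty$ for all $i$, and $A_i=A_1^{\,i}$ for all $i\ge2$. A quasi-Koszul graded quiver algebra is called Koszul. A quiver with relations $(Q,\rho)$ is a quiver $Q$ with a set $\rho$ of $K$-linear combinations of paths of $Q$; $\langle\rho\rangle$ is the two-sided ideal of $KQ$ generated by $\rho$. For $x=\sum_j k_jp_j\in KQ$ and vertices $v,w$, the component $c_{v,w}(x)$ is the part of $x$ supported on the paths from $v$ to $w$. Let $F:Q'\to Q$ be a covering of quivers with $Q'$ connected. It is regular if $F_*(\pi_1(Q',v'))$ is a normal subgroup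 of $\pi_1(Q,F(v'))$ for every vertex $v'$ of $Q'$. A lifting is a map $L:Q_0\to Q'_0$ with $F(L(v))=v$ for all $v$; for a path $p$ of $Q$ let $L(p)$ be the unique path of $Q'$ with initial vertex $L(i(p))$ and $F(L(p))=p$, and extend $L$ linearly. A Galois covering $F:(Q',\rho')\to(Q,\rho)$ of quivers with relations is a regular covering $F:Q'\to Q$ such that (1) $\rho'=\{L(r)\mid L \text{ a lifting},\ r\in\rho\}$, and (2) for all $r'\in\rho'$ and $v,w\in Q_0$ there are $v',w'\in Q'_0$ with $F(c_{v',w'}(r'))=c_{v,w}(F(r'))$. Its Galois group is the group of automorphisms of the covering $F$. Theorem. Let $Q$ be a quiver with finitely many vertices and $\rho$ a set of quadratic relations, i.e. of $K$-linear combinations of paths of length two. Suppose that $KQ/\langle\rho\rangle$ is a finite-dimensional connected (i.e. indecomposable) $K$-algebra which, graded by path length, is Koszul. Let $F:(Q',\rho')\to(Q,\rho)$ be a Galois covering whose Galois group $G$ is finite with $\operatorname{char}K\nmid|G|$. Then $Q'$ has finitely many vertices, and $KQ'/\langle\rho'\rangle$, graded by path length, is Koszul. -/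

import Mathlib

open CategoryTheory

noncomputable section

/-! ### The path algebra of a quiver -/

/-- A path of a quiver, together with its initial and its terminal vertex. Trivial paths
`Quiver.Path.nil` (one for every vertex) are included. -/
structure QuiverPath (V : Type*) [Quiver V] where
  /-- the initial vertex -/
  source : V
  /-- the terminal vertex -/
  target : V
  /-- the path itself -/
  path : Quiver.Path source target

namespace QuiverPath

variable {V : Type*} [Quiver V]

/-- The number of arrows of a path. -/
def length (p : QuiverPath V) : ℕ := p.path.length

/-- The trivial path at a vertex. -/
def trivial (v : V) : QuiverPath V := ⟨v, v, Quiver.Path.nil⟩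

/-- The concatenation "first `q`, then `p`" of two composable paths. -/
def concat (p q : QuiverPath V) (h : q.target = p.source) : QuiverPath V :=
  ⟨q.source, p.target, (q.path.cast rfl h).comp p.path⟩

/-- The image of a path under a morphism of quivers. -/
def map {W : Type*} [Quiver W] (F : V ⥤q W) (p : QuiverPath V) : QuiverPath W :=
  ⟨F.obj p.source, F.obj p.target, F.mapPath p.path⟩

theorem concat_assoc (p q r : QuiverPath V) (h : q.target = p.source)
    (h' : r.target = q.source) :
    (p.concat q h).concat r h' = p.concat (q.concat r h') h := by
  obtain ⟨_, _, p⟩ := p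
  obtain ⟨_, _, q⟩ := q
  obtain ⟨_, _, r⟩ := r
  dsimp only at h h'
  subst h h'
  simp [concat]

theorem concat_trivial (p : QuiverPath V) : p.concat (trivial p.source) rfl = p := by
  simp [concat, trivial]

theorem trivial_concat (p : QuiverPath V) : (trivial p.target).concat p rfl = p := by
  simp [concat, trivial]

end QuiverPath

/-- The path algebra `K Q` of a quiver `Q` with vertex type `V`: the `K`-vector space of (finite)
`K`-linear combinations of paths. -/
def PathAlgebra (K : Type*) [Field K] (V : Type*) [Quiver V] : Type _ := QuiverPath V →₀ K

namespace PathAlgebra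

variable {K : Type*} [Field K] {V : Type*} [Quiver V]

instance : AddCommGroup (PathAlgebra K V) := inferInstanceAs (AddCommGroup (QuiverPath V →₀ K))

instance : Module K (PathAlgebra K V) := inferInstanceAs (Module K (QuiverPath V →₀ K))

/-- The coefficients of a linear combination of paths. -/
def coeff (x : PathAlgebra K V) : QuiverPath V →₀ K := x

/-- The linear combination of paths with given coefficients. -/
def ofCoeff (x : QuiverPath V →₀ K) : PathAlgebra K V := x

/-- A path as an element of the path algebra. -/
def ofPath (p : QuiverPath V) : PathAlgebra K V := ofCoeff (Finsupp.single p 1)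

open Classical in
/-- The product `p q` of two paths: "first `q`, then `p`" if they are composable, and zero
otherwise. -/
def pathMul (p q : QuiverPath V) : PathAlgebra K V :=
  if h : q.target = p.source then ofPath (p.concat q h) else 0

/-- The bilinear extension of the product of paths. -/
def mulMap : PathAlgebra K V →ₗ[K] PathAlgebra K V →ₗ[K] PathAlgebra K V :=
  Finsupp.linearCombination K fun p => Finsupp.linearCombination K fun q => pathMul p q

instance : Mul (PathAlgebra K V) := ⟨fun x y => mulMap x y⟩

/-- The unit is the sum of the trivial paths (the quiver has finitely many vertices). -/
instance [Finite V] : One (PathAlgebra K V) := ⟨∑ᶠ v : V, ofPath (QuiverPath.trivial v)⟩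

theorem mul_def (x y : PathAlgebra K V) : x * y = mulMap x y := rfl

theorem one_def [Finite V] :
    (1 : PathAlgebra K V) = ∑ᶠ v : V, ofPath (QuiverPath.trivial v) := rfl

theorem mulMap_ofPath (p q : QuiverPath V) :
    mulMap (ofPath p) (ofPath q) = (pathMul p q : PathAlgebra K V) := by
  have h1 : mulMap (ofPath p : PathAlgebra K V) =
      Finsupp.linearCombination K fun q => (pathMul p q : PathAlgebra K V) :=
    (Finsupp.linearCombination_single _ _ _).trans (one_smul _ _)
  rw [h1]
  exact (Finsupp.linearCombination_single _ _ _).trans (one_smul _ _)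

/-- Linear maps out of the path algebra agree if they agree on paths. -/
theorem hom_ext {M : Type*} [AddCommMonoid M] [Module K M] {f g : PathAlgebra K V →ₗ[K] M}
    (h : ∀ p, f (ofPath p) = g (ofPath p)) : f = g :=
  Finsupp.lhom_ext' fun p => LinearMap.ext_ring (h p)

theorem pathMul_assoc (p q r : QuiverPath V) :
    mulMap (pathMul p q : PathAlgebra K V) (ofPath r) = mulMap (ofPath p) (pathMul q r) := by
  classical
  by_cases h : q.target = p.source <;> by_cases h' : r.target = q.source
  · have e1 : (pathMul p q : PathAlgebra K V) = ofPath (p.concat q h) := dif_pos h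
    have e2 : (pathMul q r : PathAlgebra K V) = ofPath (q.concat r h') := dif_pos h'
    rw [e1, e2, mulMap_ofPath, mulMap_ofPath]
    refine (dif_pos (show r.target = (p.concat q h).source from h')).trans ?_
    refine Eq.trans ?_ (dif_pos (show (q.concat r h').target = p.source from h)).symm
    rw [QuiverPath.concat_assoc]
  · have e1 : (pathMul p q : PathAlgebra K V) = ofPath (p.concat q h) := dif_pos h
    have e2 : (pathMul q r : PathAlgebra K V) = 0 := dif_neg h'
    rw [e1, e2, mulMap_ofPath, map_zero]
    exact dif_neg (show ¬ r.target = (p.concat q h).source from h')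
  · have e1 : (pathMul p q : PathAlgebra K V) = 0 := dif_neg h
    have e2 : (pathMul q r : PathAlgebra K V) = ofPath (q.concat r h') := dif_pos h'
    have e3 : (pathMul p (q.concat r h') : PathAlgebra K V) = 0 :=
      dif_neg (show ¬ (q.concat r h').target = p.source from h)
    rw [e1, e2, mulMap_ofPath, e3, map_zero, LinearMap.zero_apply]
  · have e1 : (pathMul p q : PathAlgebra K V) = 0 := dif_neg h
    have e2 : (pathMul q r : PathAlgebra K V) = 0 := dif_neg h'
    rw [e1, e2, map_zero, map_zero, LinearMap.zero_apply]

theorem mulMap_assoc (x y z : PathAlgebra K V) :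
    mulMap (mulMap x y) z = mulMap x (mulMap y z) := by
  have key : (mulMap (K := K) (V := V)).compr₂ mulMap =
      ((LinearMap.llcomp K _ _ _).comp mulMap).compl₂ mulMap := by
    refine hom_ext fun p => hom_ext fun q => hom_ext fun r => ?_
    simpa [mulMap_ofPath] using pathMul_assoc p q r
  simpa using congrArg (fun f => f x y z) key

theorem one_mulMap [Finite V] (x : PathAlgebra K V) : mulMap 1 x = x := by
  classical
  have := Fintype.ofFinite V
  have key : mulMap (1 : PathAlgebra K V) = LinearMap.id := by
    refine hom_ext fun p => ?_
    rw [one_def, finsum_eq_sum_of_fintype, map_sum, LinearMap.sum_apply,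
      Finset.sum_eq_single p.target]
    · rw [mulMap_ofPath]
      refine (dif_pos (show p.target = (QuiverPath.trivial p.target).source from rfl)).trans ?_
      rw [QuiverPath.trivial_concat]; rfl
    · intro v _ hv
      rw [mulMap_ofPath]
      exact dif_neg (show ¬ p.target = (QuiverPath.trivial v).source from fun h => hv h.symm)
    · simp
  rw [key]; rfl

theorem mulMap_one [Finite V] (x : PathAlgebra K V) : mulMap x 1 = x := by
  classical
  have := Fintype.ofFinite V
  have key : (mulMap (K := K) (V := V)).flip 1 = LinearMap.id := by
    refine hom_ext fun p => ?_
    rw [LinearMap.flip_apply, one_def, finsum_eq_sum_of_fintype, map_sum,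
      Finset.sum_eq_single p.source]
    · rw [mulMap_ofPath]
      refine (dif_pos (show (QuiverPath.trivial p.source).target = p.source from rfl)).trans ?_
      rw [QuiverPath.concat_trivial]; rfl
    · intro v _ hv
      rw [mulMap_ofPath]
      exact dif_neg (show ¬ (QuiverPath.trivial v).target = p.source from hv)
    · simp
  exact congrArg (fun f => f x) key

instance [Finite V] : Ring (PathAlgebra K V) where
  __ := (inferInstance : AddCommGroup (PathAlgebra K V))
  left_distrib x y z := map_add (mulMap x) y z
  right_distrib x y z := by
    change mulMap (x + y) z = mulMap x z + mulMap y z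
    rw [map_add, LinearMap.add_apply]
  zero_mul x := by
    change mulMap 0 x = 0
    rw [map_zero, LinearMap.zero_apply]
  mul_zero x := map_zero (mulMap x)
  mul_assoc := mulMap_assoc
  one_mul := one_mulMap
  mul_one := mulMap_one

instance [Finite V] : Algebra K (PathAlgebra K V) :=
  Algebra.ofModule
    (fun r x y => by
      change mulMap (r • x) y = r • mulMap x y
      rw [map_smul, LinearMap.smul_apply])
    (fun r x y => map_smul (mulMap x) r y)

/-- The linear map of path algebras induced by a morphism of quivers. -/
def map {W : Type*} [Quiver W] (F : V ⥤q W) (x : PathAlgebra K V) : PathAlgebra K W :=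
  ofCoeff (Finsupp.mapDomain (QuiverPath.map F) x.coeff)

open Classical in
/-- The `(v, w)`-component of a linear combination of paths: the part of the linear combination
that consists of the paths with initial vertex `v` and terminal vertex `w`. -/
def component (v w : V) (x : PathAlgebra K V) : PathAlgebra K V :=
  ofCoeff (x.coeff.filter fun p => p.source = v ∧ p.target = w)

/-- The linear span of the paths of length `n`. -/
def lengthPart (K : Type*) [Field K] (V : Type*) [Quiver V] (n : ℕ) :
    Submodule K (PathAlgebra K V) :=
  Submodule.span K {x | ∃ p : QuiverPath V, p.length = n ∧ x = ofPath p}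

end PathAlgebra

/-! ### Algebras given by quivers with relations -/

section QuiverAlgebra

variable {K : Type*} [Field K] {V : Type*} [Quiver V]

/-- The two-sided ideal `⟨ρ⟩` of the path algebra generated by a set `ρ` of relations. -/
def relationIdeal [Finite V] (ρ : Set (PathAlgebra K V)) : Ideal (PathAlgebra K V) :=
  (TwoSidedIdeal.span ρ).asIdeal

instance [Finite V] (ρ : Set (PathAlgebra K V)) : (relationIdeal ρ).IsTwoSided :=
  inferInstanceAs (TwoSidedIdeal.span ρ).asIdeal.IsTwoSided

/-- The algebra `K Q / ⟨ρ⟩` of a quiver with relations. -/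
abbrev QuiverAlgebra [Finite V] (ρ : Set (PathAlgebra K V)) : Type _ :=
  PathAlgebra K V ⧸ relationIdeal ρ

/-- The `n`-th piece of the length grading of `K Q / ⟨ρ⟩`: the image of the span of the paths of
length `n`. -/
def lengthGrading [Finite V] (ρ : Set (PathAlgebra K V)) (n : ℕ) :
    Submodule K (QuiverAlgebra ρ) :=
  (PathAlgebra.lengthPart K V n).map (Ideal.Quotient.mkₐ K (relationIdeal ρ)).toLinearMap

/-- A set of quadratic relations: every element is a linear combination of paths of length two. -/
def IsQuadraticRelations (ρ : Set (PathAlgebra K V)) : Prop :=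
  ∀ r ∈ ρ, r ∈ PathAlgebra.lengthPart K V 2

end QuiverAlgebra

/-- A connected (that is, indecomposable) algebra: it is nonzero and it is not the product of two
nonzero algebras, i.e. `0` and `1` are its only central idempotents. -/
def IsConnectedAlgebra (A : Type*) [Ring A] : Prop :=
  Nontrivial A ∧ ∀ e : A, IsIdempotentElem e → (∀ a, e * a = a * e) → e = 0 ∨ e = 1

/-! ### Koszul algebras -/

section Koszul

universe u

/-- A semiperfect ring: it is semisimple modulo the Jacobson radical `J`, and idempotents lift
modulo `J`. -/
def IsSemiperfect (A : Type*) [Ring A] : Prop :=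
  IsSemisimpleRing (A ⧸ Ring.jacobson A) ∧
    ∀ a : A, a * a - a ∈ Ring.jacobson A →
      ∃ e : A, IsIdempotentElem e ∧ e - a ∈ Ring.jacobson A

variable (A : Type u) [Ring A]

/-- The left `A`-module `A / J`, where `J` is the Jacobson radical of `A`. -/
abbrev topModule : ModuleCat.{u} A := ModuleCat.of A (A ⧸ Ring.jacobson A)

/-- `Ext^i_A(A/J, A/J)`. -/
abbrev YonedaExt (i : ℕ) : Type u := Abelian.Ext (topModule A) (topModule A) i

/-- The `(n + 1)`-st power of `Ext^1_A(A/J, A/J)` in the Yoneda algebra: the additive span, inside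
`Ext^{n+1}_A(A/J, A/J)`, of the Yoneda products of `n + 1` elements of degree one. (If `A` is an
algebra over a field `K`, this is a `K`-subspace, since scalars can be moved into a factor.) -/
def extOnePow : (n : ℕ) → AddSubgroup (YonedaExt A (n + 1))
  | 0 => ⊤
  | n + 1 => AddSubgroup.closure
      {z | ∃ x ∈ extOnePow n, ∃ y : YonedaExt A 1, z = Abelian.Ext.comp x y rfl}

/-- A quasi-Koszul algebra: a (left and right) noetherian semiperfect algebra whose Yoneda algebra
`⨁ Ext^i_A(A/J, A/J)` is generated in degrees `0` and `1`. -/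
structure IsQuasiKoszul : Prop where
  noetherian_left : IsNoetherianRing A
  noetherian_right : IsNoetherianRing Aᵐᵒᵖ
  semiperfect : IsSemiperfect A
  generated : ∀ i : ℕ, extOnePow A i = ⊤

variable {A} {K : Type*} [Field K] [Algebra K A]

/-- A graded quiver algebra: a graded `K`-algebra `A = ⨁ A_i` with `A_0 ≅ K^r` as `K`-algebras for
some `r ≥ 1`, with all `A_i` finite-dimensional, and generated in degrees `0` and `1`. -/
structure IsGradedQuiverAlgebra (𝒜 : ℕ → Submodule K A) : Prop where
  graded : SetLike.GradedMonoid 𝒜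
  internal : DirectSum.IsInternal 𝒜
  degree_zero : ∃ S : Subalgebra K A, Subalgebra.toSubmodule S = 𝒜 0 ∧
    ∃ r : ℕ, 1 ≤ r ∧ Nonempty (S ≃ₐ[K] (Fin r → K))
  finite : ∀ i, Module.Finite K (𝒜 i)
  generated : ∀ i, 2 ≤ i → 𝒜 i = 𝒜 1 ^ i

/-- A Koszul algebra: a quasi-Koszul graded quiver algebra. -/
structure IsKoszul (𝒜 : ℕ → Submodule K A) : Prop where
  gradedQuiverAlgebra : IsGradedQuiverAlgebra 𝒜
  quasiKoszul : IsQuasiKoszul A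

end Koszul

/-! ### Galois coverings of quivers with relations -/

/-- A connected quiver: it has a vertex, and any two vertices are joined by an unoriented path. -/
def IsConnectedQuiver (V : Type*) [Quiver V] : Prop :=
  Nonempty V ∧ ∀ v w : V, Nonempty (Quiver.Path (V := Quiver.Symmetrify V) v w)

section Covering

variable {V' V : Type*} [Quiver V'] [Quiver V]

/-- The fundamental group of a quiver at a vertex: the group of homotopy classes of unoriented
closed paths, i.e. the vertex group of the free groupoid on the quiver. -/
abbrev QuiverPi1 (v : V) : Type _ :=
  (Quiver.FreeGroupoid.of V).obj v ⟶ (Quiver.FreeGroupoid.of V).obj v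

/-- The homomorphism `F_* : π₁(Q', v') → π₁(Q, F v')` induced by a morphism `F` of quivers. -/
def Prefunctor.mapPi1 (F : V' ⥤q V) (v' : V') : QuiverPi1 v' →* QuiverPi1 (F.obj v') :=
  (Quiver.freeGroupoidFunctor F).mapVertexGroup ((Quiver.FreeGroupoid.of V').obj v')

/-- A regular covering of quivers: a covering (bijective on the outgoing and on the incoming arrows
of every vertex), with connected total quiver as usual, such that `F_*(π₁(Q', v'))` is a normal
subgroup of `π₁(Q, F v')`. -/
structure IsRegularCovering (F : V' ⥤q V) : Prop where
  connected : IsConnectedQuiver V'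
  covering : F.IsCovering
  normal : ∀ v' : V', (F.mapPi1 v').range.Normal

/-- An automorphism of a covering `F : Q' → Q`: an automorphism of the quiver `Q'` over `Q`. -/
@[ext]
structure CoveringAut (F : V' ⥤q V) where
  /-- the automorphism -/
  hom : V' ⥤q V'
  /-- its inverse -/
  inv : V' ⥤q V'
  hom_inv : hom ⋙q inv = 𝟭q V'
  inv_hom : inv ⋙q hom = 𝟭q V'
  comm : hom ⋙q F = F

namespace CoveringAut

variable {F : V' ⥤q V}

/-- The automorphisms of a covering form a group under composition. -/
instance : Group (CoveringAut F) where
  mul g h :=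
    { hom := h.hom ⋙q g.hom
      inv := g.inv ⋙q h.inv
      hom_inv := by
        rw [Prefunctor.comp_assoc, ← Prefunctor.comp_assoc g.hom, g.hom_inv, Prefunctor.id_comp,
          h.hom_inv]
      inv_hom := by
        rw [Prefunctor.comp_assoc, ← Prefunctor.comp_assoc h.inv, h.inv_hom, Prefunctor.id_comp,
          g.inv_hom]
      comm := by rw [Prefunctor.comp_assoc, g.comm, h.comm] }
  one := ⟨𝟭q V', 𝟭q V', rfl, rfl, rfl⟩
  inv g :=
    { hom := g.inv
      inv := g.hom
      hom_inv := g.inv_hom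
      inv_hom := g.hom_inv
      comm := by
        have h : g.inv ⋙q (g.hom ⋙q F) = F := by
          rw [← Prefunctor.comp_assoc, g.inv_hom, Prefunctor.id_comp]
        rwa [g.comm] at h }
  mul_assoc _ _ _ := rfl
  one_mul _ := rfl
  mul_one _ := rfl
  inv_mul_cancel g := CoveringAut.ext g.hom_inv g.hom_inv

end CoveringAut

/-- Unique path lifting: a path `p` of the base has exactly one lift with a given initial vertex
over the initial vertex of `p`. -/
theorem Prefunctor.IsCovering.existsUnique_lift {F : V' ⥤q V} (hF : F.IsCovering)
    (p : QuiverPath V) (v' : V') (hv : F.obj v' = p.source) :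
    ∃! p' : QuiverPath V', p'.source = v' ∧ p'.map F = p := by
  obtain ⟨s, t, p⟩ := p
  dsimp only at hv
  subst hv
  obtain ⟨⟨w', p'⟩, hp⟩ := (hF.pathStar_bijective v').2 ⟨t, p⟩
  have hmk : ∀ x y : Quiver.PathStar (F.obj v'), x = y →
      (⟨_, _, x.2⟩ : QuiverPath V) = ⟨_, _, y.2⟩ := by
    rintro x _ rfl; rfl
  refine ⟨⟨v', w', p'⟩, ⟨rfl, hmk _ _ hp⟩, ?_⟩
  rintro ⟨s', t', q'⟩ ⟨h1, h2⟩
  dsimp only at h1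
  subst h1
  have : F.pathStar s' ⟨t', q'⟩ = F.pathStar s' ⟨w', p'⟩ := by
    rw [hp]
    simp only [QuiverPath.map, QuiverPath.mk.injEq, true_and] at h2
    exact Sigma.ext h2.1 h2.2
  have := (hF.pathStar_bijective s').1 this
  cases this
  rfl

/-- A lifting: a map `L` from the vertices of `Q` to those of `Q'` with `L v` in the fibre of
`v`. -/
def IsLifting (F : V' ⥤q V) (L : V → V') : Prop := ∀ v, F.obj (L v) = v

/-- `L p` for a path `p` of the base and a lifting `L`: the unique path of `Q'` over `p` whose
initial vertex is the one prescribed by `L`. -/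
def liftPath {F : V' ⥤q V} (hF : F.IsCovering) {L : V → V'} (hL : IsLifting F L)
    (p : QuiverPath V) : QuiverPath V' :=
  (hF.existsUnique_lift p (L p.source) (hL p.source)).choose

theorem liftPath_spec {F : V' ⥤q V} (hF : F.IsCovering) {L : V → V'} (hL : IsLifting F L)
    (p : QuiverPath V) :
    (liftPath hF hL p).source = L p.source ∧ (liftPath hF hL p).map F = p :=
  (hF.existsUnique_lift p (L p.source) (hL p.source)).choose_spec.1

/-- `L r = ∑ kᵢ L pᵢ` for a linear combination `r = ∑ kᵢ pᵢ` of paths. -/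
def liftRelation {K : Type*} [Field K] {F : V' ⥤q V} (hF : F.IsCovering) {L : V → V'}
    (hL : IsLifting F L) (r : PathAlgebra K V) : PathAlgebra K V' :=
  PathAlgebra.ofCoeff (Finsupp.mapDomain (liftPath hF hL) r.coeff)

/-- A Galois covering `F : (Q', ρ') → (Q, ρ)` of quivers with relations; its Galois group is
`CoveringAut F`. -/
structure IsGaloisCovering {K : Type*} [Field K] (F : V' ⥤q V)
    (ρ' : Set (PathAlgebra K V')) (ρ : Set (PathAlgebra K V)) : Prop where
  regular : IsRegularCovering F
  relations_eq : ρ' = {r' | ∃ (L : V → V') (hL : IsLifting F L), ∃ r ∈ ρ,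
    r' = liftRelation regular.covering hL r}
  component_eq : ∀ r' ∈ ρ', ∀ v w : V, ∃ v' w' : V',
    PathAlgebra.map F (PathAlgebra.component v' w' r') =
      PathAlgebra.component v w (PathAlgebra.map F r')

end Covering

end

noncomputable section

/-! ### Modules over a ring that is semisimple modulo its Jacobson radical -/

section Semisimple

variable {R : Type*} [Ring R] {I : Ideal R}

/-! Write `A = KQ/⟨ρ⟩` and `B = KQ'/⟨ρ'⟩`, and let `J` denote Jacobson radicals. Sending a path to
the sum of its lifts is an algebra homomorphism `A → B` (`pullback`), and it makes `B` a finite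
projective `A`-module. Indeed a path of `Q'` is the lift of its own image at its own initial vertex,
so the trivial paths `e_x` and the functionals `b ↦ F(b e_x)` form a dual basis
(`sum_pullback_pushforward`). The functionals require `F` to induce an `A`-linear map `B → A`
(`pushforward`); condition (2) on Galois coverings is what makes it well defined. Moreover `J(B) =
J(A)B`, since both radicals are spanned by the paths of positive length.

Generation in degrees zero and one passes from `A` to `B` along any extension of this kind
(`extOnePow_eq_top_of_restrictScalars`). It says that `Ext^{n+1}(S, S)` is spanned by products of
`Ext^n(S, S)` and `Ext^1(S, S)`, with `S` the ring modulo its radical. Allow any module in the first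
argument: dimension shifting (`extFactors_succ_eq_top_iff`) trades `n` for a syzygy, down to `n =
0`. There, for `0 → N → P → M → 0` with `P` projective, the condition reads `N ∩ J²P ⊆ JN`
(`extFactors_zero_eq_top_iff`) and no longer mentions `S`. Since `J(B)X = J(A)X` for every
`B`-module `X`, and finite free `B`-modules are projective over `A`, a `B`-module satisfies the
condition as soon as its restriction to `A` does. Finally `B/J(B)`, restricted to `A`, is finite and
killed by `J(A)`, hence a direct summand of a power of `A/J(A)`, where the hypothesis on `A`
applies.

It remains to see that `Q'` is finite and `F` is onto on vertices. Regularity makes the Galois group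
transitive on fibres, so the fibres are finite. The image of `F` is closed under arrows in both
directions, so the sum of its trivial paths is a central idempotent of `A`, and connectedness makes
this idempotent `1`. -/

theorem LinearMap.apply_eq_zero_of_mem_smul_top {M S : Type*} [AddCommGroup M] [Module R M]
    [AddCommGroup S] [Module R S] (hS : Module.IsTorsionBySet R S (I : Set R)) (f : M →ₗ[R] S)
    {x : M} (hx : x ∈ (I • ⊤ : Submodule R M)) : f x = 0 := by
  refine Submodule.smul_induction_on hx (fun a ha y _ => ?_) fun y z hy hz => ?_
  · rw [map_smul]
    exact @hS (f y) ⟨a, ha⟩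
  · rw [map_add, hy, hz, add_zero]

variable [I.IsTwoSided]

theorem Ideal.Quotient.mk_smul_eq_smul {M : Type*} [AddCommGroup M] [Module R M] [Module (R ⧸ I) M]
    [IsScalarTower R (R ⧸ I) M] (a : R) (x : M) : Ideal.Quotient.mk I a • x = a • x := by
  have h : Ideal.Quotient.mk I a = a • (1 : R ⧸ I) := by
    rw [← map_one (Ideal.Quotient.mk I), ← Ideal.Quotient.mk_eq_mk, ← Ideal.Quotient.mk_eq_mk,
      ← Submodule.Quotient.mk_smul, smul_eq_mul, mul_one]
  rw [h, smul_assoc, one_smul]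

/-- A linear map between modules annihilated by a two-sided ideal `I` is linear over `R ⧸ I`. -/
def LinearMap.ofTorsionBySet {M N : Type*} [AddCommGroup M] [Module R M] [AddCommGroup N]
    [Module R N] [Module (R ⧸ I) M] [IsScalarTower R (R ⧸ I) M] [Module (R ⧸ I) N]
    [IsScalarTower R (R ⧸ I) N] (f : M →ₗ[R] N) : M →ₗ[R ⧸ I] N where
  toFun := f
  map_add' := f.map_add
  map_smul' a x := by
    obtain ⟨a, rfl⟩ := Ideal.Quotient.mk_surjective a
    rw [RingHom.id_apply, Ideal.Quotient.mk_smul_eq_smul, Ideal.Quotient.mk_smul_eq_smul,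
      f.map_smul]

theorem isTorsionBySet_quotient_self : Module.IsTorsionBySet R (R ⧸ I) (I : Set R) := by
  rintro x ⟨a, ha⟩
  obtain ⟨x, rfl⟩ := Ideal.Quotient.mk_surjective x
  change a • (Submodule.Quotient.mk x : R ⧸ I) = 0
  rw [← Submodule.Quotient.mk_smul, Submodule.Quotient.mk_eq_zero]
  exact I.mul_mem_right x ha

variable [IsSemisimpleRing (R ⧸ I)]

/-- Modules annihilated by `I` are injective relative to each other when `R ⧸ I` is semisimple. -/
theorem exists_extension_of_isTorsionBySet {X W S : Type*} [AddCommGroup X] [Module R X]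
    [AddCommGroup W] [Module R W] [AddCommGroup S] [Module R S]
    (hX : Module.IsTorsionBySet R X (I : Set R)) (hW : Module.IsTorsionBySet R W (I : Set R))
    (hS : Module.IsTorsionBySet R S (I : Set R)) (i : X →ₗ[R] W) (hi : Function.Injective i)
    (g : X →ₗ[R] S) : ∃ h : W →ₗ[R] S, h ∘ₗ i = g := by
  let := hX.module
  let := hW.module
  let := hS.module
  have : IsScalarTower R (R ⧸ I) X := hX.isScalarTower
  have : IsScalarTower R (R ⧸ I) W := hW.isScalarTower
  have : IsScalarTower R (R ⧸ I) S := hS.isScalarTower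
  obtain ⟨h, hh⟩ := IsSemisimpleModule.extension_property (LinearMap.ofTorsionBySet (I := I) i) hi
    (LinearMap.ofTorsionBySet (I := I) g)
  exact ⟨h.restrictScalars R, LinearMap.ext fun x => LinearMap.congr_fun hh x⟩

/-- Linear maps to `R ⧸ I` separate the points of a module annihilated by `I`. -/
theorem exists_linearMap_ne_zero_of_isTorsionBySet {X : Type*} [AddCommGroup X] [Module R X]
    (hX : Module.IsTorsionBySet R X (I : Set R)) {x : X} (hx : x ≠ 0) :
    ∃ g : X →ₗ[R] R ⧸ I, g x ≠ 0 := by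
  let := hX.module
  have : IsScalarTower R (R ⧸ I) X := hX.isScalarTower
  -- `X` is projective over the semisimple ring `R ⧸ I`, so it embeds in a free module; a nonzero
  -- coordinate of `x` is the required map.
  obtain ⟨s, hs⟩ := (Module.projective_def' (R := R ⧸ I) (P := X)).1
    (Module.projective_of_isSemisimpleRing _ _)
  have hsx : s x ≠ 0 := fun h => hx <| by
    simpa [h] using (LinearMap.congr_fun hs x).symm
  obtain ⟨y, hy⟩ := Finsupp.ne_iff.1 hsx
  exact ⟨((Finsupp.lapply y).comp s).restrictScalars R, hy⟩

/-- A finite module annihilated by `I` is a direct summand of a power of `R ⧸ I`. -/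
theorem exists_sum_comp_eq_of_isTorsionBySet {X : Type*} [AddCommGroup X] [Module R X]
    [Module.Finite R X] (hX : Module.IsTorsionBySet R X (I : Set R)) :
    ∃ (k : ℕ) (f : Fin k → X →ₗ[R] R ⧸ I) (s : Fin k → (R ⧸ I) →ₗ[R] X),
      ∀ x, ∑ i, s i (f i x) = x := by
  let := hX.module
  have : IsScalarTower R (R ⧸ I) X := hX.isScalarTower
  have : Module.Finite (R ⧸ I) X := Module.Finite.of_restrictScalars_finite R _ _
  have : Module.Projective (R ⧸ I) X := Module.projective_of_isSemisimpleRing _ _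
  obtain ⟨k, p, hp⟩ := Module.Finite.exists_fin' (R ⧸ I) X
  obtain ⟨s, hs⟩ := Module.projective_lifting_property p LinearMap.id hp
  refine ⟨k, fun i => ((LinearMap.proj i).comp s).restrictScalars R,
    fun i => (p.comp (LinearMap.single _ _ i)).restrictScalars R, fun x => ?_⟩
  have h := LinearMap.congr_fun hs x
  rw [LinearMap.comp_apply, LinearMap.id_apply, ← Finset.univ_sum_single (s x), map_sum] at h
  exact h

theorem exists_linearMap_apply_ne_zero_of_notMem_smul_top {N : Type*} [AddCommGroup N] [Module R N]
    {x : N} (hx : x ∉ (I • ⊤ : Submodule R N)) : ∃ g : N →ₗ[R] R ⧸ I, g x ≠ 0 := by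
  obtain ⟨g, hg⟩ := exists_linearMap_ne_zero_of_isTorsionBySet
    (Module.isTorsionBySet_quotient_ideal_smul N I)
    (x := Submodule.Quotient.mk x) (by rwa [ne_eq, Submodule.Quotient.mk_eq_zero])
  exact ⟨g.comp (Submodule.mkQ _), hg⟩

/-- A linear map `N → S` with `I S = 0` extends along an injection `i : N → L` as soon as
`i⁻¹(I L) = I N`. -/
theorem exists_extension_of_comap_smul_top_le {N L S : Type*} [AddCommGroup N] [Module R N]
    [AddCommGroup L] [Module R L] [AddCommGroup S] [Module R S]
    (hS : Module.IsTorsionBySet R S (I : Set R)) (i : N →ₗ[R] L)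
    (hi : ∀ x, i x ∈ (I • ⊤ : Submodule R L) → x ∈ (I • ⊤ : Submodule R N)) (g : N →ₗ[R] S) :
    ∃ h : L →ₗ[R] S, h ∘ₗ i = g := by
  have hle : (I • ⊤ : Submodule R N) ≤ (I • ⊤ : Submodule R L).comap i := by
    rw [← Submodule.map_le_iff_le_comap, Submodule.map_smul'']
    exact Submodule.smul_mono le_rfl le_top
  -- The hypothesis on `i` is exactly the injectivity of the induced map `N/IN → L/IL`, and `g`
  -- factors through `N/IN`.
  let i' : (N ⧸ (I • ⊤ : Submodule R N)) →ₗ[R] (L ⧸ (I • ⊤ : Submodule R L)) :=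
    Submodule.mapQ _ _ i hle
  let g' : (N ⧸ (I • ⊤ : Submodule R N)) →ₗ[R] S :=
    Submodule.liftQ _ g fun x hx => g.apply_eq_zero_of_mem_smul_top hS hx
  obtain ⟨h, hh⟩ := exists_extension_of_isTorsionBySet
    (Module.isTorsionBySet_quotient_ideal_smul N I)
    (Module.isTorsionBySet_quotient_ideal_smul L I) hS i'
    (by
      rw [← LinearMap.ker_eq_bot, Submodule.ker_mapQ, eq_bot_iff]
      rintro _ ⟨x, hx, rfl⟩
      rw [Submodule.mem_bot, Submodule.mkQ_apply, Submodule.Quotient.mk_eq_zero]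
      exact hi x hx) g'
  exact ⟨h ∘ₗ Submodule.mkQ _, LinearMap.ext fun x => LinearMap.congr_fun hh (Submodule.Quotient.mk x)⟩

end Semisimple

/-! ### Generation of extension groups in degree one -/

section ExtFactors

universe u v w

open Abelian

section Abelian

variable {C : Type u} [Category.{v} C] [Abelian C] [HasExt.{w} C]

/-- The subgroup of `Ext^{n+1}(X, S)` spanned by the Yoneda products of elements of `Ext^n(X, S)`
and of `Ext^1(S, S)`. -/
def extFactors (X S : C) (n : ℕ) : AddSubgroup (Ext.{w} X S (n + 1)) :=
  AddSubgroup.closure {z | ∃ (x : Ext X S n) (y : Ext S S 1), z = x.comp y rfl}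

theorem comp_mem_extFactors {X S : C} {n : ℕ} (x : Ext.{w} X S n) (y : Ext.{w} S S 1) :
    x.comp y rfl ∈ extFactors X S n :=
  AddSubgroup.subset_closure ⟨x, y, rfl⟩

/-- Dimension shifting for the generation of extension groups in degree one. -/
theorem extFactors_succ_eq_top_iff {T : ShortComplex C} (hT : T.ShortExact) [Projective T.X₂]
    (S : C) (n : ℕ) :
    extFactors.{u, v, w} T.X₃ S (n + 1) = ⊤ ↔ extFactors.{u, v, w} T.X₁ S n = ⊤ := by
  -- `Ext` out of the projective middle term vanishes in positive degrees. Hence the connecting map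
  -- is onto in every degree `m`, including `m = 0`, but injective only from degree one on.
  have hsurj : ∀ {m : ℕ} (z : Ext.{w} T.X₃ S (m + 1)),
      ∃ x : Ext.{w} T.X₁ S m, hT.extClass.comp x (add_comm 1 m) = z := fun z =>
    Ext.contravariant_sequence_exact₃ hT S z (Ext.eq_zero_of_projective _) _
  have hinj : ∀ {m : ℕ} (x : Ext.{w} T.X₁ S (m + 1)),
      hT.extClass.comp x (add_comm 1 (m + 1)) = 0 → x = 0 := by
    intro m x hx
    obtain ⟨y, rfl⟩ := Ext.contravariant_sequence_exact₁ hT S x _ hx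
    rw [Ext.eq_zero_of_projective y, Ext.comp_zero]
  let D : Ext.{w} T.X₁ S (n + 1) →+ Ext.{w} T.X₃ S (n + 1 + 1) :=
    hT.extClass.precomp S (add_comm 1 (n + 1))
  -- By associativity the connecting map carries `x y` to `(D x) y`. Only its surjectivity is needed
  -- for the left factor, whose degree `n` may be zero.
  have hmap : (extFactors.{u, v, w} T.X₁ S n).map D = extFactors.{u, v, w} T.X₃ S (n + 1) := by
    rw [extFactors, AddMonoidHom.map_closure, extFactors]
    congr 1
    ext z
    constructor
    · rintro ⟨_, ⟨x, y, rfl⟩, rfl⟩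
      exact ⟨hT.extClass.comp x (add_comm 1 n), y,
        (Ext.comp_assoc hT.extClass x y (add_comm 1 n) rfl (by lia)).symm⟩
    · rintro ⟨x, y, rfl⟩
      obtain ⟨x, rfl⟩ := hsurj x
      exact ⟨_, ⟨x, y, rfl⟩,
        (Ext.comp_assoc hT.extClass x y (add_comm 1 n) rfl (by lia)).symm⟩
  have hD : Function.Injective D := (injective_iff_map_eq_zero D).2 fun x hx => hinj x hx
  have hD' : Function.Surjective D := fun z => hsurj z
  rw [← hmap]
  constructor
  · intro h
    apply AddSubgroup.map_injective hD
    rw [h, AddSubgroup.map_top_of_surjective _ hD']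
  · intro h
    rw [h, AddSubgroup.map_top_of_surjective _ hD']

/-- If `X` is a direct summand of a power of `S`, generation in degree one passes from `S` to
`X`. -/
theorem extFactors_eq_top_of_sum_comp_eq_id {X S : C} {k : ℕ} (f : Fin k → (X ⟶ S))
    (s : Fin k → (S ⟶ X)) (hfs : ∑ i, f i ≫ s i = 𝟙 X) {n : ℕ}
    (h : extFactors.{u, v, w} S S n = ⊤) : extFactors.{u, v, w} X S n = ⊤ := by
  rw [eq_top_iff]
  rintro z -
  have hz : z = ∑ i, (Ext.mk₀ (f i)).comp ((Ext.mk₀ (s i)).comp z (zero_add _)) (zero_add _) := by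
    conv_lhs => rw [← Ext.mk₀_id_comp z, ← hfs, Ext.mk₀_sum, Ext.sum_comp]
    refine Finset.sum_congr rfl fun i _ => ?_
    rw [← Ext.mk₀_comp_mk₀, Ext.comp_assoc (a₂₃ := n + 1) _ _ _ (by lia) (by lia) (by lia)]
  rw [hz]
  refine AddSubgroup.sum_mem _ fun i _ => ?_
  have hi : (Ext.mk₀ (s i)).comp z (zero_add _) ∈ extFactors.{u, v, w} S S n := h ▸ trivial
  generalize (Ext.mk₀ (s i)).comp z (zero_add _) = t at hi
  refine AddSubgroup.closure_induction ?_ ?_ ?_ ?_ hi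
  · rintro _ ⟨x, y, rfl⟩
    rw [← Ext.comp_assoc (Ext.mk₀ (f i)) x y (zero_add n) rfl (by lia)]
    exact comp_mem_extFactors _ _
  · rw [Ext.comp_zero]
    exact zero_mem _
  · intro x y _ _ hx hy
    rw [Ext.comp_add]
    exact add_mem hx hy
  · intro x _ hx
    rw [Ext.comp_neg]
    exact neg_mem hx

end Abelian

/-- The Yoneda algebra of `A / J` is generated in degrees zero and one exactly if all its
extension groups factor through those of degree one. -/
theorem extOnePow_eq_top_iff {A : Type u} [Ring A] :
    (∀ i, extOnePow A i = ⊤) ↔ ∀ i, extFactors (topModule A) (topModule A) i = ⊤ := by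
  constructor
  -- Index `i` concerns `Ext^{i+1}` on both sides. At `i = 0` the left factor has degree zero, and
  -- the identity serves.
  · rintro h (_ | i)
    · rw [eq_top_iff]
      rintro z -
      rw [← Ext.mk₀_id_comp z]
      exact comp_mem_extFactors _ _
    · rw [eq_top_iff, ← h (i + 1)]
      refine AddSubgroup.closure_mono ?_
      rintro _ ⟨x, -, y, rfl⟩
      exact ⟨x, y, rfl⟩
  · intro h i
    induction i with
    | zero => rfl
    | succ i ih =>
      rw [eq_top_iff, ← h (i + 1)]
      refine AddSubgroup.closure_mono ?_
      rintro _ ⟨x, y, rfl⟩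
      exact ⟨x, ih ▸ AddSubgroup.mem_top x, y, rfl⟩

/-! ### A module-theoretic criterion -/

section Criterion

variable {R : Type u} [Ring R]

/-- The short complex of modules given by an exact pair of linear maps. -/
abbrev moduleShortComplex {N P M : Type u} [AddCommGroup N] [Module R N] [AddCommGroup P] [Module R P]
    [AddCommGroup M] [Module R M] (ι : N →ₗ[R] P) (π : P →ₗ[R] M) (h : Function.Exact ι π) :
    ShortComplex (ModuleCat.{u} R) :=
  ShortComplex.mk (ModuleCat.ofHom ι) (ModuleCat.ofHom π)
    (by ext x; exact h.apply_apply_eq_zero x)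

theorem moduleShortComplex_shortExact {N P M : Type u} [AddCommGroup N] [Module R N]
    [AddCommGroup P] [Module R P] [AddCommGroup M] [Module R M] {ι : N →ₗ[R] P} {π : P →ₗ[R] M}
    (hι : Function.Injective ι) (h : Function.Exact ι π) (hπ : Function.Surjective π) :
    (moduleShortComplex ι π h).ShortExact :=
  have : Mono (moduleShortComplex ι π h).f := (ModuleCat.mono_iff_injective _).2 hι
  have : Epi (moduleShortComplex ι π h).g := (ModuleCat.epi_iff_surjective _).2 hπ
  ⟨ModuleCat.shortComplex_exact _ h⟩

variable [IsSemisimpleRing (R ⧸ Ring.jacobson R)]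

/-- A finite module killed by the radical is a direct summand of a power of `R/J`, and the condition
passes to such summands. -/
theorem extFactors_eq_top_of_isTorsionBySet
    (h : ∀ n, extFactors (topModule R) (topModule R) n = ⊤) {X : Type u} [AddCommGroup X]
    [Module R X] [Module.Finite R X] (hX : Module.IsTorsionBySet R X (Ring.jacobson R : Set R))
    (n : ℕ) : extFactors (ModuleCat.of R X) (topModule R) n = ⊤ := by
  obtain ⟨k, f, s, hfs⟩ := exists_sum_comp_eq_of_isTorsionBySet hX
  refine extFactors_eq_top_of_sum_comp_eq_id (fun i => ModuleCat.ofHom (f i))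
    (fun i => ModuleCat.ofHom (s i)) ?_ (h n)
  ext x
  simpa using hfs x

/-- For `0 → N → P → M → 0` with `P` projective and `M` finite, the products of degree one span
`Ext^1(M, R/J)` exactly if `N ∩ J²P = JN`. -/
theorem extFactors_zero_eq_top_iff {N P M : Type u} [AddCommGroup N] [Module R N]
    [AddCommGroup P] [Module R P] [AddCommGroup M] [Module R M] [Module.Projective R P]
    [Module.Finite R M] {ι : N →ₗ[R] P} {π : P →ₗ[R] M}
    (hι : Function.Injective ι) (h : Function.Exact ι π) (hπ : Function.Surjective π) :
    extFactors (ModuleCat.of R M) (topModule R) 0 = ⊤ ↔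
      ∀ x : N, ι x ∈ (Ring.jacobson R • (Ring.jacobson R • ⊤) : Submodule R P) →
        x ∈ (Ring.jacobson R • ⊤ : Submodule R N) := by
  set J := Ring.jacobson R with hJ
  let T := M ⧸ (J • ⊤ : Submodule R M)
  let q : M →ₗ[R] T := Submodule.mkQ _
  -- The same `P` also covers `T = M/JM`, with kernel `L = JP + N`. Comparing `0 → N → P → M → 0`
  -- with `0 → L → P → T → 0` turns statements about `Ext^1` into the question which maps `N → R/J`
  -- extend to `L`.
  let L : Submodule R P := LinearMap.ker (q ∘ₗ π)
  have hιL : ∀ x, ι x ∈ L := fun x => by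
    simp [L, h.apply_apply_eq_zero x]
  let j : N →ₗ[R] L := ι.codRestrict L hιL
  have hexT : Function.Exact L.subtype (q ∘ₗ π) := LinearMap.exact_subtype_ker_map _
  have hT := moduleShortComplex_shortExact L.subtype_injective hexT
    ((Submodule.mkQ_surjective _).comp hπ)
  have hM := moduleShortComplex_shortExact hι h hπ
  have hP : Projective (ModuleCat.of R P) := (IsProjective.iff_projective P).1 ‹_›
  have hPM : Projective (moduleShortComplex ι π h).X₂ := hP
  have hPT : Projective (moduleShortComplex L.subtype (q ∘ₗ π) hexT).X₂ := hP
  let φ : moduleShortComplex ι π h ⟶ moduleShortComplex L.subtype (q ∘ₗ π) hexT :=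
    { τ₁ := ModuleCat.ofHom j
      τ₂ := 𝟙 _
      τ₃ := ModuleCat.ofHom q
      comm₁₂ := by ext x; rfl
      comm₂₃ := by ext x; rfl }
  have hnat : hM.extClass.comp (Ext.mk₀ (ModuleCat.ofHom j)) (add_zero 1) =
      (Ext.mk₀ (ModuleCat.ofHom q)).comp hT.extClass (zero_add 1) :=
    ShortComplex.ShortExact.extClass_naturality hM hT φ
  have hS : Module.IsTorsionBySet R (R ⧸ J) (J : Set R) := isTorsionBySet_quotient_self
  have hTT : Module.IsTorsionBySet R T (J : Set R) := Module.isTorsionBySet_quotient_ideal_smul M J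
  have hL : (J • ⊤ : Submodule R P) ≤ L := fun x hx =>
    (q ∘ₗ π).apply_eq_zero_of_mem_smul_top hTT hx
  have hL' : L ≤ (J • ⊤ : Submodule R P) ⊔ LinearMap.range ι := by
    intro x hx
    have hx' : π x ∈ (J • ⊤ : Submodule R M) := by
      rw [← Submodule.Quotient.mk_eq_zero]
      exact hx
    rw [← LinearMap.range_eq_top.2 hπ, LinearMap.range_eq_map, ← Submodule.map_smul''] at hx'
    obtain ⟨y, hy, hxy⟩ := hx'
    obtain ⟨z, hz⟩ := (h (x - y)).1 (by rw [map_sub, hxy, sub_self])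
    rw [← add_sub_cancel y x, ← hz]
    exact Submodule.add_mem_sup hy ⟨z, rfl⟩
  -- As `P` is projective, every class in `Ext^1(T, R/J)` comes from a map on `L`.
  have hlift : ∀ z : Ext (ModuleCat.of R T) (topModule R) 1, ∃ g : L →ₗ[R] R ⧸ J,
      hT.extClass.comp (Ext.mk₀ (ModuleCat.ofHom g)) (add_zero 1) = z := by
    intro z
    obtain ⟨x, hx⟩ := Ext.contravariant_sequence_exact₃ hT (topModule R) z
      (Ext.eq_zero_of_projective _) (add_zero 1)
    obtain ⟨g, rfl⟩ := Ext.addEquiv₀.symm.surjective x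
    exact ⟨g.hom, hx⟩
  constructor
  · intro htop x hx
    by_contra hxN
    obtain ⟨g, hg⟩ := exists_linearMap_apply_ne_zero_of_notMem_smul_top hxN
    -- Every map `M → R/J` factors through `T`, so all products are pulled back from `Ext^1(T,
    -- R/J)`.
    have hle : extFactors (ModuleCat.of R M) (topModule R) 0 ≤
        ((Ext.mk₀ (ModuleCat.ofHom q)).precomp (topModule R) (zero_add 1)).range := by
      refine (AddSubgroup.closure_le _).2 ?_
      rintro _ ⟨x, y, rfl⟩
      obtain ⟨f, rfl⟩ := Ext.addEquiv₀.symm.surjective x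
      let f' : T →ₗ[R] R ⧸ J := Submodule.liftQ _ f.hom fun x hx =>
        f.hom.apply_eq_zero_of_mem_smul_top hS hx
      have hf : f = ModuleCat.ofHom q ≫ ModuleCat.ofHom f' := by
        ext x; rfl
      refine ⟨(Ext.mk₀ (ModuleCat.ofHom f')).comp y (zero_add 1), ?_⟩
      change (Ext.mk₀ (ModuleCat.ofHom q)).comp
        ((Ext.mk₀ (ModuleCat.ofHom f')).comp y (zero_add 1)) (zero_add 1) = (Ext.mk₀ f).comp y _
      rw [hf, ← Ext.mk₀_comp_mk₀, Ext.comp_assoc (a₂₃ := 1) _ _ _ (by lia) (by lia) (by lia)]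
    obtain ⟨z, hz⟩ := hle (htop ▸ AddSubgroup.mem_top
      (hM.extClass.comp (Ext.mk₀ (ModuleCat.ofHom g)) (add_zero 1)))
    obtain ⟨g', rfl⟩ := hlift z
    -- Hence the class of `g` is also the class of `g' ∘ j`, and the difference `g' ∘ j - g` extends
    -- to a map `u` on `P`.
    have h0 : hM.extClass.comp (Ext.mk₀ (ModuleCat.ofHom (g' ∘ₗ j - g))) (add_zero 1) = 0 := by
      have : ModuleCat.ofHom (g' ∘ₗ j - g) =
          ModuleCat.ofHom j ≫ ModuleCat.ofHom g' - ModuleCat.ofHom g := rfl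
      have hsub : Ext.mk₀ (ModuleCat.ofHom (g' ∘ₗ j - g)) =
          Ext.mk₀ (ModuleCat.ofHom j ≫ ModuleCat.ofHom g') - Ext.mk₀ (ModuleCat.ofHom g) := by
        rw [this]
        exact map_sub Ext.addEquiv₀.symm _ _
      rw [hsub, sub_eq_add_neg, Ext.comp_add, Ext.comp_neg, ← Ext.mk₀_comp_mk₀,
        ← Ext.comp_assoc (a₁₂ := 1) _ _ _ (by lia) (by lia) (by lia), hnat,
        Ext.comp_assoc (a₂₃ := 1) _ _ _ (by lia) (by lia) (by lia), add_neg_eq_zero]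
      exact hz
    obtain ⟨u, hu⟩ := Ext.contravariant_sequence_exact₁ hM (topModule R) _ _ h0
    obtain ⟨u, rfl⟩ := Ext.addEquiv₀.symm.surjective u
    change (Ext.mk₀ (ModuleCat.ofHom ι)).comp (Ext.mk₀ u) _ = _ at hu
    rw [Ext.mk₀_comp_mk₀] at hu
    have hu' := (Ext.mk₀_bijective _ _).1 hu
    have hu'' : u.hom (ι x) = g' (j x) - g x := LinearMap.congr_fun (congrArg ModuleCat.Hom.hom hu') x
    -- Evaluate at `x` with `ι x ∈ J²P`: `u` vanishes on `JP`, and `g'` vanishes on `JL`, which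
    -- contains `J²P`. So `g x = 0`, contrary to the choice of `g`.
    have h1 : u.hom (ι x) = 0 :=
      u.hom.apply_eq_zero_of_mem_smul_top hS (Submodule.smul_mono le_rfl le_top hx)
    have h2 : g' (j x) = 0 := by
      refine g'.apply_eq_zero_of_mem_smul_top hS ?_
      have := Submodule.smul_mono (le_refl J) hL hx
      rw [← L.range_subtype, LinearMap.range_eq_map, ← Submodule.map_smul''] at this
      obtain ⟨y, hy, hxy⟩ := this
      rwa [show j x = y from Subtype.ext hxy.symm]
    rw [h1, h2, zero_sub, eq_comm, neg_eq_zero] at hu''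
    exact hg hu''
  · intro hN
    rw [eq_top_iff]
    rintro z -
    obtain ⟨x, rfl⟩ := Ext.contravariant_sequence_exact₃ hM (topModule R) z
      (Ext.eq_zero_of_projective _) (add_zero 1)
    obtain ⟨g, rfl⟩ := Ext.addEquiv₀.symm.surjective x
    -- The condition for extending `g` to `L` is `N ∩ JL ⊆ JN`. As `JL ⊆ J²P + JN`, subtracting an
    -- element of `JN` reduces it to the hypothesis on `N ∩ J²P`.
    obtain ⟨g', hg'⟩ := exists_extension_of_comap_smul_top_le hS j (fun x hx => by
      have hx' : ι x ∈ (J • L : Submodule R P) := by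
        have := Submodule.mem_map_of_mem (f := L.subtype) hx
        rwa [Submodule.map_smul'', ← LinearMap.range_eq_map, L.range_subtype] at this
      have hx'' := Submodule.smul_mono (le_refl J) hL' hx'
      rw [Submodule.smul_sup, LinearMap.range_eq_map, ← Submodule.map_smul''] at hx''
      obtain ⟨y, hy, _, ⟨w, hw, rfl⟩, hyw⟩ := Submodule.mem_sup.1 hx''
      rw [← sub_add_cancel x w]
      refine add_mem (hN _ ?_) hw
      rwa [map_sub, ← hyw, add_sub_cancel_right]) g.hom
    have hgg : g = ModuleCat.ofHom j ≫ ModuleCat.ofHom g' := by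
      ext x; exact (LinearMap.congr_fun hg' x).symm
    obtain ⟨k, f, s, hfs⟩ := exists_sum_comp_eq_of_isTorsionBySet hTT
    have hz : hM.extClass.comp (Ext.addEquiv₀.symm g) (add_zero 1) =
        (Ext.mk₀ (ModuleCat.ofHom q)).comp
          (hT.extClass.comp (Ext.mk₀ (ModuleCat.ofHom g')) (add_zero 1)) (zero_add 1) := by
      change hM.extClass.comp (Ext.mk₀ g) (add_zero 1) = _
      rw [hgg, ← Ext.mk₀_comp_mk₀,
        ← Ext.comp_assoc (a₁₂ := 1) _ _ _ (by lia) (by lia) (by lia), hnat,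
        Ext.comp_assoc (a₂₃ := 1) _ _ _ (by lia) (by lia) (by lia)]
    rw [hz]
    generalize hT.extClass.comp (Ext.mk₀ (ModuleCat.ofHom g')) (add_zero 1) = t
    -- The class is now `q` followed by some `t` in `Ext^1(T, R/J)`. Splitting the identity of `T`
    -- through copies of `R/J` gives a sum of products of `q ≫ f i` and `s i` followed by `t`.
    have hid : ∑ i, ModuleCat.ofHom (f i) ≫ ModuleCat.ofHom (s i) = 𝟙 (ModuleCat.of R T) := by
      refine ModuleCat.hom_ext (LinearMap.ext fun x => ?_)
      simpa using hfs x
    rw [← Ext.mk₀_id_comp t, ← hid, Ext.mk₀_sum, Ext.sum_comp, Ext.comp_sum]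
    refine AddSubgroup.sum_mem _ fun i _ => ?_
    rw [← Ext.mk₀_comp_mk₀, Ext.comp_assoc (a₂₃ := 1) _ _ _ (by lia) (by lia) (by lia),
      ← Ext.comp_assoc (a₁₂ := 0) _ _ _ (by lia) (by lia) (by lia)]
    exact comp_mem_extFactors (n := 0) _ _

end Criterion

end ExtFactors

/-! ### Descent of generation in degree one along a finite projective extension -/

section RestrictScalars

universe u v

variable {A : Type u} [Ring A] {B : Type v} [Ring B] [Module A B]
  (hJ : ∀ b : B, b ∈ Ring.jacobson B ↔ b ∈ (Ring.jacobson A • ⊤ : Submodule A B))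

-- The radical filtration of a `B`-module is visible over `A`: `J(B)N = J(A)BN = J(A)N`.
include hJ in
theorem mem_jacobson_smul_iff_restrictScalars {M : Type*} [AddCommGroup M] [Module B M]
    [Module A M] [IsScalarTower A B M] (N : Submodule B M) (x : M) :
    x ∈ Ring.jacobson B • N ↔ x ∈ Ring.jacobson A • N.restrictScalars A := by
  constructor
  · intro hx
    refine Submodule.smul_induction_on hx (fun b hb y hy => ?_) fun y z => add_mem
    refine Submodule.smul_induction_on ((hJ b).1 hb) (fun a ha b _ => ?_) fun b c hb hc => ?_
    · rw [smul_assoc]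
      exact Submodule.smul_mem_smul ha (N.smul_mem b hy)
    · rw [add_smul]
      exact add_mem hb hc
  · intro hx
    refine Submodule.smul_induction_on hx (fun a ha y hy => ?_) fun y z => add_mem
    rw [← one_smul B y, ← smul_assoc]
    exact Submodule.smul_mem_smul ((hJ _).2 (Submodule.smul_mem_smul ha trivial)) hy

theorem LinearEquiv.mem_smul_top_iff {R M M' : Type*} [Ring R] [AddCommGroup M] [Module R M]
    [AddCommGroup M'] [Module R M'] (e : M ≃ₗ[R] M') (I : Ideal R) (N : Submodule R M)
    (N' : Submodule R M') (hN : ∀ x, e x ∈ N' ↔ x ∈ N) (x : M) : e x ∈ I • N' ↔ x ∈ I • N := by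
  have : N.map (e : M →ₗ[R] M') = N' := by
    ext y
    obtain ⟨y, rfl⟩ := e.surjective y
    simp [hN]
  rw [← this, ← Submodule.map_smul'']
  exact ⟨fun ⟨y, hy, hxy⟩ => e.injective hxy ▸ hy, Submodule.mem_map_of_mem⟩

variable [IsScalarTower A B B] [Module.Finite A B] [Module.Projective A B] [IsSemisimpleRing (A ⧸ Ring.jacobson A)]
  [IsSemisimpleRing (B ⧸ Ring.jacobson B)] [IsNoetherianRing B]

-- A presentation of `M` by a finite free `B`-module is also a projective presentation over `A`,
-- with the same syzygy, so induction on `n` reduces to `n = 0`. There the criterion involves only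
-- the radical filtrations, which agree over `A` and `B`. The copy `M₀` of `M` is needed because `A`
-- and `B` may lie in different universes.
include hJ in
theorem extFactors_eq_top_of_restrictScalars (n : ℕ) {M : Type v} [AddCommGroup M] [Module B M]
    [Module.Finite B M] [Module A M] [IsScalarTower A B M] {M₀ : Type u} [AddCommGroup M₀]
    [Module A M₀] (e : M₀ ≃ₗ[A] M)
    (h : extFactors (ModuleCat.of A M₀) (topModule A) n = ⊤) :
    extFactors (ModuleCat.of B M) (topModule B) n = ⊤ := by
  induction n using Nat.strong_induction_on generalizing M M₀ with | _ n ih => ?_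
  obtain ⟨k, π, hπ⟩ := Module.Finite.exists_fin' B M
  let N := LinearMap.ker π
  have hex : Function.Exact N.subtype π := LinearMap.exact_subtype_ker_map π
  have : Module.Finite A M := Module.Finite.trans B M
  have : Module.Finite A M₀ := Module.Finite.equiv e.symm
  -- A finite `A`-module is a quotient of some `A^m`, hence has a model in the universe of `A`.
  have hsmall : ∀ (L : Type v) [AddCommGroup L] [Module A L] [Module.Finite A L], Small.{u} L := by
    intro L _ _ _
    obtain ⟨m, p, hp⟩ := Module.Finite.exists_fin' A L
    exact small_of_surjective hp
  have : Module.Finite A (Fin k → B) := inferInstance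
  have : Module.Finite A N := Module.Finite.trans B N
  have := hsmall (Fin k → B)
  have := hsmall N
  let eP : Shrink.{u} (Fin k → B) ≃ₗ[A] (Fin k → B) := Shrink.linearEquiv A _
  let eN : Shrink.{u} N ≃ₗ[A] N := Shrink.linearEquiv A _
  have : Module.Projective A (Fin k → B) :=
    Module.Projective.of_equiv (DFinsupp.linearEquivFunOnFintype (R := A) (M := fun _ : Fin k => B))
  have : Module.Projective A (Shrink.{u} (Fin k → B)) := Module.Projective.of_equiv eP.symm
  let ι₀ : Shrink.{u} N →ₗ[A] Shrink.{u} (Fin k → B) :=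
    eP.symm.toLinearMap ∘ₗ N.subtype.restrictScalars A ∘ₗ eN.toLinearMap
  let π₀ : Shrink.{u} (Fin k → B) →ₗ[A] M₀ :=
    e.symm.toLinearMap ∘ₗ π.restrictScalars A ∘ₗ eP.toLinearMap
  have hι₀ : Function.Injective ι₀ :=
    eP.symm.injective.comp (N.subtype_injective.comp eN.injective)
  have hπ₀ : Function.Surjective π₀ := e.symm.surjective.comp (hπ.comp eP.surjective)
  have hex₀ : Function.Exact ι₀ π₀ := by
    intro y
    have h1 : π₀ y = 0 ↔ π (eP y) = 0 := e.symm.map_eq_zero_iff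
    rw [h1, hex]
    constructor
    · rintro ⟨x, hx⟩
      refine ⟨eN.symm x, ?_⟩
      change eP.symm (N.subtype (eN (eN.symm x))) = y
      rw [eN.apply_symm_apply, hx, eP.symm_apply_apply]
    · rintro ⟨x, rfl⟩
      exact ⟨eN x, (eP.apply_symm_apply _).symm⟩
  rcases n with _ | n
  · rw [extFactors_zero_eq_top_iff hι₀ hex₀ hπ₀] at h
    rw [extFactors_zero_eq_top_iff N.subtype_injective hex hπ]
    intro x hx
    have hx' := h (eN.symm x)
    have hι : ι₀ (eN.symm x) = eP.symm (N.subtype x) := by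
      change eP.symm (N.subtype (eN (eN.symm x))) = _
      rw [eN.apply_symm_apply]
    rw [hι, LinearEquiv.mem_smul_top_iff eP.symm _ (Ring.jacobson A • ⊤) _ (fun y =>
      LinearEquiv.mem_smul_top_iff eP.symm _ ⊤ ⊤ (fun _ => Iff.rfl) y),
      LinearEquiv.mem_smul_top_iff eN.symm _ ⊤ ⊤ (fun _ => Iff.rfl)] at hx'
    refine (mem_jacobson_smul_iff_restrictScalars hJ ⊤ x).2 (hx' ?_)
    rw [mem_jacobson_smul_iff_restrictScalars hJ] at hx
    convert hx using 2
    ext y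
    exact (mem_jacobson_smul_iff_restrictScalars hJ ⊤ y).symm
  · have : Projective (ModuleCat.of A (Shrink.{u} (Fin k → B))) :=
      (IsProjective.iff_projective _).1 inferInstance
    have : Projective (ModuleCat.of B (Fin k → B)) :=
      (IsProjective.iff_projective _).1 inferInstance
    have : Projective (moduleShortComplex ι₀ π₀ hex₀).X₂ := ‹_›
    have : Projective (moduleShortComplex N.subtype π hex).X₂ := ‹_›
    refine (extFactors_succ_eq_top_iff
      (moduleShortComplex_shortExact N.subtype_injective hex hπ) _ n).2 ?_
    exact ih n n.lt_succ_self eN ((extFactors_succ_eq_top_iff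
      (moduleShortComplex_shortExact hι₀ hex₀ hπ₀) _ n).1 h)

include hJ in
/-- If `B` is finite projective over `A` and `J(B) = J(A) B`, generation of the Yoneda algebra in
degrees zero and one passes from `A` to `B`. -/
theorem extOnePow_eq_top_of_restrictScalars (h : ∀ i, extOnePow A i = ⊤) (i : ℕ) :
    extOnePow B i = ⊤ := by
  rw [extOnePow_eq_top_iff] at h
  revert i
  rw [extOnePow_eq_top_iff]
  intro n
  have : Module.Finite A (B ⧸ Ring.jacobson B) := Module.Finite.trans B _
  obtain ⟨m, p, hp⟩ := Module.Finite.exists_fin' A (B ⧸ Ring.jacobson B)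
  have : Small.{u} (B ⧸ Ring.jacobson B) := small_of_surjective hp
  let e : Shrink.{u} (B ⧸ Ring.jacobson B) ≃ₗ[A] (B ⧸ Ring.jacobson B) := Shrink.linearEquiv A _
  have : Module.Finite A (Shrink.{u} (B ⧸ Ring.jacobson B)) := Module.Finite.equiv e.symm
  -- It suffices that `J(A)` kills `B/J(B)`, which holds because `a • 1` lies in `J(B)` for `a` in
  -- `J(A)`.
  refine extFactors_eq_top_of_restrictScalars hJ n e (extFactors_eq_top_of_isTorsionBySet h ?_ n)
  rintro x ⟨a, ha⟩
  apply e.injective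
  rw [map_zero]
  change e (a • x) = 0
  rw [map_smul, ← one_smul B (e x), ← smul_assoc]
  exact @isTorsionBySet_quotient_self _ _ (Ring.jacobson B) _ (e x)
    ⟨_, (hJ _).2 (Submodule.smul_mem_smul ha trivial)⟩

end RestrictScalars

/-! ### Paths and the path algebra -/

namespace QuiverPath

variable {V : Type*} [Quiver V]

theorem length_concat (p q : QuiverPath V) (h : q.target = p.source) :
    (p.concat q h).length = p.length + q.length := by
  obtain ⟨_, _, p⟩ := p
  obtain ⟨_, _, q⟩ := q
  dsimp only at h
  subst h
  simp [concat, length, add_comm]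

@[simp]
theorem length_trivial (v : V) : (trivial v).length = 0 := rfl

theorem eq_trivial_of_length_eq_zero {p : QuiverPath V} (h : p.length = 0) :
    p = trivial p.source := by
  obtain ⟨s, t, p⟩ := p
  cases p with
  | nil => rfl
  | cons p e => simp [length] at h

/-- An arrow as a path of length one. -/
def ofArrow {v w : V} (e : v ⟶ w) : QuiverPath V := ⟨v, w, e.toPath⟩

theorem exists_eq_ofArrow_concat {p : QuiverPath V} {n : ℕ} (h : p.length = n + 1) :
    ∃ (a q : QuiverPath V) (haq : q.target = a.source), a.length = 1 ∧ q.length = n ∧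
      a.concat q haq = p := by
  obtain ⟨s, t, p⟩ := p
  cases p with
  | nil => simp [length] at h
  | cons p e => exact ⟨ofArrow e, ⟨s, _, p⟩, rfl, rfl, Nat.succ_injective h, rfl⟩

end QuiverPath

namespace PathAlgebra

variable {K : Type*} [Field K] {V : Type*} [Quiver V]

theorem ofPath_mul_ofPath {p q : QuiverPath V} (h : q.target = p.source) :
    (ofPath p * ofPath q : PathAlgebra K V) = ofPath (p.concat q h) :=
  (mulMap_ofPath p q).trans (dif_pos h)

theorem ofPath_mul_ofPath_of_ne {p q : QuiverPath V} (h : q.target ≠ p.source) :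
    (ofPath p * ofPath q : PathAlgebra K V) = 0 :=
  (mulMap_ofPath p q).trans (dif_neg h)

theorem span_range_ofPath :
    Submodule.span K (Set.range (ofPath : QuiverPath V → PathAlgebra K V)) = ⊤ :=
  eq_top_iff.2 fun x _ => by
    refine Finsupp.induction_linear (motive := fun y : QuiverPath V →₀ K =>
      ofCoeff y ∈ Submodule.span K (Set.range (ofPath : QuiverPath V → PathAlgebra K V))) x
      (zero_mem _) (fun f g hf hg => add_mem hf hg) fun p c => ?_
    have h : ofCoeff (Finsupp.single p c) = c • (ofPath p : PathAlgebra K V) := by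
      change Finsupp.single p c = c • Finsupp.single p (1 : K)
      rw [Finsupp.smul_single, smul_eq_mul, mul_one]
    rw [h]
    exact Submodule.smul_mem _ _ (Submodule.subset_span ⟨p, rfl⟩)

theorem one_eq_sum [Fintype V] :
    (1 : PathAlgebra K V) = ∑ v : V, ofPath (QuiverPath.trivial v) := by
  rw [one_def, finsum_eq_sum_of_fintype]

/-- The linear extension of a map defined on paths. -/
def liftLinear {M : Type*} [AddCommGroup M] [Module K M] (f : QuiverPath V → M) :
    PathAlgebra K V →ₗ[K] M :=
  Finsupp.linearCombination K f

@[simp]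
theorem liftLinear_ofPath {M : Type*} [AddCommGroup M] [Module K M] (f : QuiverPath V → M)
    (p : QuiverPath V) : liftLinear f (ofPath p : PathAlgebra K V) = f p :=
  (Finsupp.linearCombination_single _ _ _).trans (one_smul _ _)

theorem linearMap_mul_of_ofPath [Finite V] {B : Type*} [Ring B] [Algebra K B]
    (T : PathAlgebra K V →ₗ[K] B)
    (h : ∀ p q, T (ofPath p * ofPath q) = T (ofPath p) * T (ofPath q)) (x y : PathAlgebra K V) :
    T (x * y) = T x * T y := by
  have key : (LinearMap.mul K (PathAlgebra K V)).compr₂ T =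
      (LinearMap.mul K B).compl₁₂ T T :=
    hom_ext fun p => hom_ext fun q => by simpa using h p q
  simpa using congrArg (fun f => f x y) key

/-- The algebra homomorphism out of a path algebra given by a multiplicative map on paths. -/
def liftAlgHom [Fintype V] {B : Type*} [Ring B] [Algebra K B] (f : QuiverPath V → B)
    (h_one : ∑ v : V, f (QuiverPath.trivial v) = 1)
    (h_mul : ∀ p q h, f (p.concat q h) = f p * f q)
    (h_zero : ∀ p q : QuiverPath V, q.target ≠ p.source → f p * f q = 0) :
    PathAlgebra K V →ₐ[K] B :=
  AlgHom.ofLinearMap (liftLinear f)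
    (by simp only [one_eq_sum, map_sum, liftLinear_ofPath, h_one])
    (linearMap_mul_of_ofPath _ fun p q => by
      by_cases h : q.target = p.source
      · simp only [ofPath_mul_ofPath h, liftLinear_ofPath, h_mul]
      · simp only [ofPath_mul_ofPath_of_ne h, liftLinear_ofPath, h_zero p q h, map_zero])

@[simp]
theorem liftAlgHom_ofPath [Fintype V] {B : Type*} [Ring B] [Algebra K B] (f : QuiverPath V → B)
    (h_one h_mul h_zero) (p : QuiverPath V) :
    liftAlgHom (K := K) f h_one h_mul h_zero (ofPath p) = f p :=
  liftLinear_ofPath f p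

end PathAlgebra

/-! ### Quadratic algebras -/

namespace QuiverAlgebra

open PathAlgebra

variable {K : Type*} [Field K] {V : Type*} [Quiver V] [Finite V] (ρ : Set (PathAlgebra K V))

/-- The projection from the path algebra. -/
abbrev mk : PathAlgebra K V →ₐ[K] QuiverAlgebra ρ := Ideal.Quotient.mkₐ K (relationIdeal ρ)

/-- The class of a path. -/
def ofPath (p : QuiverPath V) : QuiverAlgebra ρ := mk ρ (PathAlgebra.ofPath p)

theorem mk_ofPath (p : QuiverPath V) : mk ρ (PathAlgebra.ofPath p) = ofPath ρ p := rfl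

theorem mk_surjective : Function.Surjective (mk ρ) := Ideal.Quotient.mk_surjective

variable {ρ}

theorem mk_eq_zero_of_mem {r : PathAlgebra K V} (hr : r ∈ ρ) : mk ρ r = 0 :=
  Ideal.Quotient.eq_zero_iff_mem.2 (TwoSidedIdeal.subset_span hr)

theorem ofPath_mul_ofPath {p q : QuiverPath V} (h : q.target = p.source) :
    ofPath ρ p * ofPath ρ q = ofPath ρ (p.concat q h) := by
  rw [ofPath, ofPath, ← map_mul, PathAlgebra.ofPath_mul_ofPath h, ofPath]

theorem ofPath_mul_ofPath_of_ne {p q : QuiverPath V} (h : q.target ≠ p.source) :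
    ofPath ρ p * ofPath ρ q = 0 := by
  rw [ofPath, ofPath, ← map_mul, PathAlgebra.ofPath_mul_ofPath_of_ne h, map_zero]

theorem one_eq_sum [Fintype V] :
    (1 : QuiverAlgebra ρ) = ∑ v : V, ofPath ρ (QuiverPath.trivial v) := by
  rw [← map_one (mk ρ), PathAlgebra.one_eq_sum, map_sum]
  rfl

variable (ρ) in
theorem span_range_ofPath : Submodule.span K (Set.range (ofPath ρ)) = ⊤ := by
  have h := congrArg (Submodule.map (mk ρ).toLinearMap) (PathAlgebra.span_range_ofPath (K := K) (V := V))
  rw [Submodule.map_span, Submodule.map_top, LinearMap.range_eq_top.2 (mk_surjective ρ),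
    ← Set.range_comp] at h
  exact h

theorem linearMap_ext {M : Type*} [AddCommMonoid M] [Module K M] {f g : QuiverAlgebra ρ →ₗ[K] M}
    (h : ∀ p, f (ofPath ρ p) = g (ofPath ρ p)) : f = g :=
  LinearMap.ext_on_range (span_range_ofPath ρ) h

theorem eq_zero_of_mem_relationIdeal {B : Type*} [Ring B] [Algebra K B]
    (f : PathAlgebra K V →ₐ[K] B) (hf : ∀ r ∈ ρ, f r = 0) {x : PathAlgebra K V}
    (hx : x ∈ relationIdeal ρ) : f x = 0 := by
  have h : TwoSidedIdeal.span ρ ≤ TwoSidedIdeal.ker f :=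
    TwoSidedIdeal.span_le.2 fun r hr => (TwoSidedIdeal.mem_ker f).2 (hf r hr)
  exact (TwoSidedIdeal.mem_ker f).1 (h hx)

/-- The algebra homomorphism induced by one on the path algebra that kills the relations. -/
def lift {B : Type*} [Ring B] [Algebra K B] (f : PathAlgebra K V →ₐ[K] B)
    (hf : ∀ r ∈ ρ, f r = 0) : QuiverAlgebra ρ →ₐ[K] B :=
  Ideal.Quotient.liftₐ _ f fun _ => eq_zero_of_mem_relationIdeal f hf

@[simp]
theorem lift_ofPath {B : Type*} [Ring B] [Algebra K B] (f : PathAlgebra K V →ₐ[K] B)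
    (hf : ∀ r ∈ ρ, f r = 0) (p : QuiverPath V) :
    lift f hf (ofPath ρ p) = f (PathAlgebra.ofPath p) := rfl

variable (ρ) in
theorem lengthGrading_eq_span (n : ℕ) :
    lengthGrading ρ n = Submodule.span K {x | ∃ p : QuiverPath V, p.length = n ∧ ofPath ρ p = x} := by
  rw [lengthGrading, lengthPart, Submodule.map_span]
  congr 1
  ext x
  constructor
  · rintro ⟨_, ⟨p, hp, rfl⟩, rfl⟩
    exact ⟨p, hp, rfl⟩
  · rintro ⟨p, hp, rfl⟩
    exact ⟨_, ⟨p, hp, rfl⟩, rfl⟩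

theorem ofPath_mem_lengthGrading (p : QuiverPath V) : ofPath ρ p ∈ lengthGrading ρ p.length := by
  rw [lengthGrading_eq_span]
  exact Submodule.subset_span ⟨p, rfl, rfl⟩

theorem lengthGrading_mul_le (m n : ℕ) :
    lengthGrading ρ m * lengthGrading ρ n ≤ lengthGrading ρ (m + n) := by
  rw [lengthGrading_eq_span ρ m, lengthGrading_eq_span ρ n, Submodule.span_mul_span,
    Submodule.span_le]
  rintro _ ⟨_, ⟨p, rfl, rfl⟩, _, ⟨q, rfl, rfl⟩, rfl⟩
  dsimp only
  by_cases h : q.target = p.source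
  · rw [ofPath_mul_ofPath h, ← QuiverPath.length_concat p q h]
    exact ofPath_mem_lengthGrading _
  · rw [ofPath_mul_ofPath_of_ne h]
    exact zero_mem _

theorem lengthGrading_succ (n : ℕ) :
    lengthGrading ρ (n + 1) = lengthGrading ρ 1 * lengthGrading ρ n := by
  refine le_antisymm ?_ ((lengthGrading_mul_le 1 n).trans_eq (by rw [add_comm]))
  rw [lengthGrading_eq_span, Submodule.span_le]
  rintro _ ⟨p, hp, rfl⟩
  obtain ⟨a, q, h, ha, hq, rfl⟩ := QuiverPath.exists_eq_ofArrow_concat hp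
  rw [← ofPath_mul_ofPath h]
  exact Submodule.mul_mem_mul (ha ▸ ofPath_mem_lengthGrading a) (hq ▸ ofPath_mem_lengthGrading q)

theorem lengthGrading_eq_pow (n : ℕ) :
    lengthGrading ρ (n + 1) = lengthGrading ρ 1 ^ (n + 1) := by
  induction n with
  | zero => rw [pow_one]
  | succ n ih => rw [lengthGrading_succ, ih, ← pow_succ']

variable (ρ) in
theorem gradedMonoid_lengthGrading : SetLike.GradedMonoid (lengthGrading ρ) where
  one_mem := by
    have := Fintype.ofFinite V
    rw [one_eq_sum]
    exact sum_mem fun v _ => ofPath_mem_lengthGrading (QuiverPath.trivial v)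
  mul_mem _ _ _ _ hx hy := lengthGrading_mul_le _ _ (Submodule.mul_mem_mul hx hy)

/-! ### Quadratic relations: length grading, augmentation and radical -/

section Quadratic

variable (hρ : IsQuadraticRelations ρ)

open Polynomial in
theorem gradingPathHom_aux [Fintype V] : ∑ v : V, monomial (QuiverPath.trivial v).length
    (ofPath ρ (QuiverPath.trivial v)) = 1 := by
  simp only [QuiverPath.length_trivial, ← map_sum, ← one_eq_sum]
  rfl

open Polynomial in
/-- The homomorphism of algebras sending a path `p` to `p t ^ (length p)`. -/
def gradingPathHom [Fintype V] : PathAlgebra K V →ₐ[K] (QuiverAlgebra ρ)[X] :=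
  liftAlgHom (fun p => monomial p.length (ofPath ρ p)) gradingPathHom_aux
    (fun p q h => by rw [monomial_mul_monomial, QuiverPath.length_concat, ofPath_mul_ofPath h])
    (fun p q h => by rw [monomial_mul_monomial, ofPath_mul_ofPath_of_ne h, map_zero])

open Polynomial in
theorem gradingPathHom_of_mem_lengthPart [Fintype V] {n : ℕ} {x : PathAlgebra K V}
    (hx : x ∈ lengthPart K V n) : gradingPathHom (ρ := ρ) x = monomial n (mk ρ x) := by
  induction hx using Submodule.span_induction with
  | mem x h =>
    obtain ⟨p, rfl, rfl⟩ := h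
    exact liftAlgHom_ofPath _ _ _ _ p
  | zero => simp
  | add x y _ _ hx hy => rw [map_add, hx, hy, map_add, map_add]
  | smul c x _ hx => rw [map_smul, hx, map_smul, smul_monomial]

open Polynomial in
/-- For quadratic relations, the homomorphism `a ↦ ∑ aₙ tⁿ` with `aₙ` the component of
degree `n`. -/
def gradingHom [Fintype V] : QuiverAlgebra ρ →ₐ[K] (QuiverAlgebra ρ)[X] :=
  lift gradingPathHom fun r hr => by
    rw [gradingPathHom_of_mem_lengthPart (hρ r hr), mk_eq_zero_of_mem hr, map_zero]

open Polynomial in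
theorem gradingHom_of_mem [Fintype V] {n : ℕ} {a : QuiverAlgebra ρ} (ha : a ∈ lengthGrading ρ n) :
    gradingHom hρ a = monomial n a := by
  obtain ⟨x, hx, rfl⟩ := ha
  exact gradingPathHom_of_mem_lengthPart hx

-- Homogeneity of the relations makes `p ↦ p t^(length p)` well defined on the quotient. The
-- coefficients of this homomorphism recover the components of a sum, so the sum of the graded
-- pieces is direct.
include hρ in
theorem isInternal_lengthGrading : DirectSum.IsInternal (lengthGrading ρ) := by
  have := Fintype.ofFinite V
  constructor
  · have key : ∀ (x : DirectSum ℕ fun n => lengthGrading ρ n) (n : ℕ),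
        (gradingHom hρ (DirectSum.coeAddMonoidHom (lengthGrading ρ) x)).coeff n = x n := by
      intro x n
      induction x using DirectSum.induction_on with
      | zero => simp
      | of i a =>
        rw [DirectSum.coeAddMonoidHom_of, gradingHom_of_mem hρ a.2, Polynomial.coeff_monomial]
        split_ifs with h
        · subst h
          rw [DirectSum.of_eq_same]
        · rw [DirectSum.of_eq_of_ne _ _ _ (Ne.symm h), Submodule.coe_zero]
      | add x y hx hy =>
        rw [map_add, map_add, Polynomial.coeff_add, hx, hy, DirectSum.add_apply,
          Submodule.coe_add]
    intro x y hxy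
    refine DFinsupp.ext fun n => Subtype.ext ?_
    rw [← key x n, ← key y n, hxy]
  · intro a
    have ha : a ∈ Submodule.span K (Set.range (ofPath ρ)) := by
      rw [span_range_ofPath]; trivial
    have hle : Submodule.span K (Set.range (ofPath ρ)) ≤
        LinearMap.range (DirectSum.coeLinearMap (lengthGrading ρ)) := by
      rw [Submodule.span_le]
      rintro _ ⟨p, rfl⟩
      exact ⟨DirectSum.of (fun n => lengthGrading ρ n) _ ⟨_, ofPath_mem_lengthGrading p⟩,
        DirectSum.coeAddMonoidHom_of _ _ _⟩
    exact hle ha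

open Classical in
/-- The homomorphism of algebras `KQ → K^{Q₀}` killing all arrows. -/
def augmentationPathHom [Fintype V] : PathAlgebra K V →ₐ[K] (V → K) :=
  liftAlgHom (fun p => if p.length = 0 then Pi.single p.source 1 else 0)
    (by
      simp only [QuiverPath.length_trivial, if_true]
      exact Finset.univ_sum_single (1 : V → K))
    (fun p q h => by
      rw [QuiverPath.length_concat]
      by_cases hp : p.length = 0 <;> by_cases hq : q.length = 0
      · have e : q.source = p.source := by
          rw [QuiverPath.eq_trivial_of_length_eq_zero hq] at h
          exact h
        have e' : (p.concat q h).source = p.source := e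
        rw [if_pos hp, if_pos hq, if_pos (by rw [hp, hq]), e, e', ← Pi.single_mul, one_mul]
      · simp [hp, hq]
      · simp [hp, hq]
      · simp [hp, hq])
    (fun p q h => by
      by_cases hp : p.length = 0 <;> by_cases hq : q.length = 0
      · have e : q.source ≠ p.source := by
          rw [QuiverPath.eq_trivial_of_length_eq_zero hq] at h
          exact h
        rw [if_pos hp, if_pos hq]
        ext v
        rw [Pi.mul_apply, Pi.single_apply, Pi.single_apply]
        split_ifs with h1 h2
        · exact absurd (h2.symm.trans h1) e
        all_goals simp
      · simp [hq]
      · simp [hp]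
      · simp [hp])

open Classical in
theorem augmentationPathHom_ofPath [Fintype V] (p : QuiverPath V) :
    augmentationPathHom (PathAlgebra.ofPath p : PathAlgebra K V) =
      if p.length = 0 then Pi.single p.source 1 else 0 :=
  liftAlgHom_ofPath _ _ _ _ p

theorem augmentationPathHom_of_mem_lengthPart [Fintype V] {n : ℕ} (hn : n ≠ 0)
    {x : PathAlgebra K V} (hx : x ∈ lengthPart K V n) : augmentationPathHom x = 0 := by
  induction hx using Submodule.span_induction with
  | mem x h =>
    obtain ⟨p, rfl, rfl⟩ := h
    exact (augmentationPathHom_ofPath p).trans (if_neg hn)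
  | zero => simp
  | add x y _ _ hx hy => rw [map_add, hx, hy, add_zero]
  | smul c x _ hx => rw [map_smul, hx, smul_zero]

/-- The augmentation `KQ/⟨ρ⟩ → K^{Q₀}` for quadratic relations. -/
def augmentation [Fintype V] : QuiverAlgebra ρ →ₐ[K] (V → K) :=
  lift augmentationPathHom fun r hr => augmentationPathHom_of_mem_lengthPart two_ne_zero (hρ r hr)

theorem augmentation_ofPath_trivial [Fintype V] [DecidableEq V] (v : V) :
    augmentation hρ (ofPath ρ (QuiverPath.trivial v)) = Pi.single v 1 := by
  rw [augmentation, lift_ofPath, augmentationPathHom_ofPath, if_pos (QuiverPath.length_trivial v)]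
  unfold QuiverPath.trivial
  congr!

theorem augmentation_ofPath_of_length_ne_zero [Fintype V] {p : QuiverPath V} (hp : p.length ≠ 0) :
    augmentation hρ (ofPath ρ p) = 0 := by
  rw [augmentation, lift_ofPath, augmentationPathHom_ofPath, if_neg hp]

variable (ρ) in
/-- The section `K^{Q₀} → KQ/⟨ρ⟩` of the augmentation. -/
def vertexHom [Fintype V] : (V → K) →ₐ[K] QuiverAlgebra ρ :=
  AlgHom.ofLinearMap (Fintype.linearCombination K fun v => ofPath ρ (QuiverPath.trivial v))
    (by simp [Fintype.linearCombination_apply, one_eq_sum])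
    (fun f g => by
      simp only [Fintype.linearCombination_apply, Finset.sum_mul_sum]
      refine Finset.sum_congr rfl fun v _ => ?_
      rw [Finset.sum_eq_single v]
      · rw [smul_mul_smul_comm, ofPath_mul_ofPath rfl]
        rfl
      · intro w _ hw
        rw [smul_mul_smul_comm, ofPath_mul_ofPath_of_ne (by exact hw), smul_zero]
      · simp)

theorem vertexHom_apply [Fintype V] (f : V → K) :
    vertexHom ρ f = ∑ v, f v • ofPath ρ (QuiverPath.trivial v) := rfl

theorem augmentation_vertexHom [Fintype V] (f : V → K) :
    augmentation hρ (vertexHom ρ f) = f := by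
  classical
  simp only [vertexHom_apply, map_sum, map_smul, augmentation_ofPath_trivial]
  ext w
  simp [Finset.sum_apply, Pi.single_apply]

variable (ρ) in
/-- The span of the paths of length at least `n`. -/
def lengthGE (n : ℕ) : Submodule K (QuiverAlgebra ρ) :=
  Submodule.span K {x | ∃ p : QuiverPath V, n ≤ p.length ∧ ofPath ρ p = x}

theorem ofPath_mem_lengthGE {p : QuiverPath V} {n : ℕ} (h : n ≤ p.length) :
    ofPath ρ p ∈ lengthGE ρ n :=
  Submodule.subset_span ⟨p, h, rfl⟩

theorem lengthGE_le {n : ℕ} {N : Submodule K (QuiverAlgebra ρ)}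
    (h : ∀ p : QuiverPath V, n ≤ p.length → ofPath ρ p ∈ N) : lengthGE ρ n ≤ N := by
  refine Submodule.span_le.2 ?_
  rintro _ ⟨p, hp, rfl⟩
  exact h p hp

theorem pow_mem_lengthGE {x : QuiverAlgebra ρ} (hx : x ∈ lengthGE ρ 1) (n : ℕ) :
    x ^ n ∈ lengthGE ρ n := by
  induction n with
  | zero =>
    have h : lengthGE ρ 0 = ⊤ := by
      rw [← span_range_ofPath ρ, lengthGE]
      congr 1
      ext x
      simp
    rw [h]
    trivial
  | succ n ih =>
    have hle : lengthGE ρ n * lengthGE ρ 1 ≤ lengthGE ρ (n + 1) := by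
      rw [lengthGE, lengthGE, Submodule.span_mul_span, Submodule.span_le]
      rintro _ ⟨_, ⟨p, hp, rfl⟩, _, ⟨q, hq, rfl⟩, rfl⟩
      dsimp only
      by_cases h : q.target = p.source
      · rw [ofPath_mul_ofPath h]
        exact ofPath_mem_lengthGE (by rw [QuiverPath.length_concat]; lia)
      · rw [ofPath_mul_ofPath_of_ne h]
        exact zero_mem _
    rw [pow_succ]
    exact hle (Submodule.mul_mem_mul ih hx)

/-- The algebra is the sum of the span of the trivial paths and the span of the paths of positive
length; this identifies the kernel of the augmentation. -/
theorem sub_vertexHom_augmentation_mem [Fintype V] (a : QuiverAlgebra ρ) :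
    a - vertexHom ρ (augmentation hρ a) ∈ lengthGE ρ 1 := by
  classical
  have ha : a ∈ Submodule.span K (Set.range (ofPath ρ)) := by
    rw [span_range_ofPath]; trivial
  have hle : Submodule.span K (Set.range (ofPath ρ)) ≤ (lengthGE ρ 1).comap
      (LinearMap.id - (vertexHom ρ).toLinearMap ∘ₗ (augmentation hρ).toLinearMap) := by
    rw [Submodule.span_le]
    rintro _ ⟨p, rfl⟩
    change ofPath ρ p - vertexHom ρ (augmentation hρ (ofPath ρ p)) ∈ lengthGE ρ 1
    by_cases hp : p.length = 0
    · rw [QuiverPath.eq_trivial_of_length_eq_zero hp, augmentation_ofPath_trivial, vertexHom_apply]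
      simp [Pi.single_apply]
    · rw [augmentation_ofPath_of_length_ne_zero hρ hp, map_zero, sub_zero]
      exact ofPath_mem_lengthGE (Nat.one_le_iff_ne_zero.2 hp)
  exact hle ha

theorem augmentation_eq_zero_iff [Fintype V] {a : QuiverAlgebra ρ} :
    augmentation hρ a = 0 ↔ a ∈ lengthGE ρ 1 := by
  constructor
  · intro ha
    have h := sub_vertexHom_augmentation_mem hρ a
    rwa [ha, map_zero, sub_zero] at h
  · intro ha
    have hle : lengthGE ρ 1 ≤ LinearMap.ker (augmentation hρ).toLinearMap := by
      refine lengthGE_le fun p hp => ?_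
      exact augmentation_ofPath_of_length_ne_zero hρ (Nat.one_le_iff_ne_zero.1 hp)
    exact hle ha

/-! ### The finite-dimensional case: the Jacobson radical and semiperfectness -/

variable [Module.Finite K (QuiverAlgebra ρ)]

-- In finite dimension only finitely many summands of a direct sum are nonzero, so all sufficiently
-- long paths vanish.
include hρ in
theorem exists_lengthGE_eq_bot : ∃ n, lengthGE ρ n = ⊥ := by
  have hfin := WellFoundedGT.finite_ne_bot_of_iSupIndep
    (isInternal_lengthGrading hρ).submodule_iSupIndep
  obtain ⟨N, hN⟩ := hfin.bddAbove
  refine ⟨N + 1, ?_⟩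
  rw [lengthGE, Submodule.span_eq_bot]
  rintro _ ⟨p, hp, rfl⟩
  by_contra h
  have : p.length ≤ N := hN (fun h' => h <| by
    have := ofPath_mem_lengthGrading (ρ := ρ) p
    rwa [h', Submodule.mem_bot] at this)
  lia

theorem isNilpotent_of_augmentation_eq_zero [Fintype V] {a : QuiverAlgebra ρ}
    (ha : augmentation hρ a = 0) : IsNilpotent a := by
  obtain ⟨n, hn⟩ := exists_lengthGE_eq_bot hρ
  refine ⟨n, ?_⟩
  rw [← Submodule.mem_bot K, ← hn]
  exact pow_mem_lengthGE ((augmentation_eq_zero_iff hρ).1 ha) n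

/-- The augmentation maps onto the semisimple ring `K^{Q₀}`, so it kills the radical. Conversely its
kernel is a nil ideal, so `1 + y a` is a unit for every `a` in it. -/
theorem mem_jacobson_iff_augmentation_eq_zero [Fintype V] {a : QuiverAlgebra ρ} :
    a ∈ Ring.jacobson (QuiverAlgebra ρ) ↔ augmentation hρ a = 0 := by
  constructor
  · intro ha
    have : RingHomSurjective (augmentation hρ).toRingHom :=
      ⟨fun f => ⟨_, augmentation_vertexHom hρ f⟩⟩
    have h := Ring.le_comap_jacobson (augmentation hρ).toRingHom ha
    rwa [Ideal.mem_comap, IsSemisimpleRing.jacobson_eq_bot, Submodule.mem_bot] at h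
  · intro ha
    rw [← Ideal.jacobson_bot, Ideal.mem_jacobson_iff]
    intro y
    have hnil : IsNilpotent (y * a) :=
      isNilpotent_of_augmentation_eq_zero hρ (by rw [map_mul, ha, mul_zero])
    obtain ⟨u, hu⟩ := hnil.isUnit_one_add
    refine ⟨(u⁻¹ : (QuiverAlgebra ρ)ˣ), ?_⟩
    have h : (u⁻¹ : (QuiverAlgebra ρ)ˣ) * (1 + y * a) = 1 := by rw [← hu, Units.inv_mul]
    rw [Ideal.mem_bot, ← h]
    noncomm_ring

include hρ in
/-- The Jacobson radical is the span of the paths of positive length. -/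
theorem mem_jacobson_iff {a : QuiverAlgebra ρ} :
    a ∈ Ring.jacobson (QuiverAlgebra ρ) ↔ a ∈ lengthGE ρ 1 := by
  have := Fintype.ofFinite V
  rw [mem_jacobson_iff_augmentation_eq_zero hρ, augmentation_eq_zero_iff]

include hρ in
theorem isSemisimpleRing_quotient_jacobson :
    IsSemisimpleRing (QuiverAlgebra ρ ⧸ Ring.jacobson (QuiverAlgebra ρ)) := by
  have := Fintype.ofFinite V
  refine RingHom.isSemisimpleRing_of_surjective
    ((Ideal.Quotient.mk (Ring.jacobson (QuiverAlgebra ρ))).comp (vertexHom ρ).toRingHom) ?_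
  intro x
  obtain ⟨a, rfl⟩ := Ideal.Quotient.mk_surjective x
  refine ⟨augmentation hρ a, ?_⟩
  symm
  refine Ideal.Quotient.eq.2 ?_
  rw [mem_jacobson_iff hρ]
  exact sub_vertexHom_augmentation_mem hρ a

include hρ in
theorem isSemiperfect : IsSemiperfect (QuiverAlgebra ρ) := by
  have := Fintype.ofFinite V
  refine ⟨isSemisimpleRing_quotient_jacobson hρ, fun a ha => ?_⟩
  rw [mem_jacobson_iff_augmentation_eq_zero hρ, map_sub, map_mul, sub_eq_zero] at ha
  -- Idempotents lift along a homomorphism with nil kernel.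
  obtain ⟨e, he, hea⟩ := exists_isIdempotentElem_eq_of_ker_isNilpotent
    (augmentation hρ).toRingHom (fun x hx => isNilpotent_of_augmentation_eq_zero hρ hx)
    (augmentation hρ a) ⟨a, rfl⟩ ha
  refine ⟨e, he, ?_⟩
  rw [mem_jacobson_iff_augmentation_eq_zero hρ, map_sub, sub_eq_zero]
  exact hea

include hρ in
theorem isGradedQuiverAlgebra_lengthGrading [Nonempty V] :
    IsGradedQuiverAlgebra (lengthGrading ρ) where
  graded := gradedMonoid_lengthGrading ρ
  internal := isInternal_lengthGrading hρ
  degree_zero := by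
    have := Fintype.ofFinite V
    refine ⟨(vertexHom ρ).range, ?_, Fintype.card V, Fintype.card_pos, ⟨?_⟩⟩
    · rw [lengthGrading_eq_span]
      apply le_antisymm
      · rintro _ ⟨f, rfl⟩
        change vertexHom ρ f ∈ _
        rw [vertexHom_apply]
        exact sum_mem fun v _ => Submodule.smul_mem _ _ (Submodule.subset_span ⟨_, rfl, rfl⟩)
      · rw [Submodule.span_le]
        rintro _ ⟨p, hp, rfl⟩
        classical
        refine ⟨Pi.single p.source 1, ?_⟩
        rw [QuiverPath.eq_trivial_of_length_eq_zero hp]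
        change vertexHom ρ _ = _
        rw [vertexHom_apply]
        simp [Pi.single_apply, QuiverPath.trivial]
    · have hinj : Function.Injective (vertexHom ρ) :=
        Function.LeftInverse.injective (augmentation_vertexHom hρ)
      exact (AlgEquiv.ofInjective _ hinj).symm.trans
        (AlgEquiv.piCongrLeft K (fun _ => K) (Fintype.equivFin V))
  finite _ := inferInstance
  generated i hi := by
    obtain ⟨i, rfl⟩ := Nat.exists_eq_add_of_le' hi
    exact lengthGrading_eq_pow (i + 1)

include hρ in
/-- A finite-dimensional quadratic quiver algebra is Koszul as soon as its Yoneda algebra is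
generated in degrees zero and one. -/
theorem isKoszul_lengthGrading [Nonempty V] (h : ∀ i, extOnePow (QuiverAlgebra ρ) i = ⊤) :
    IsKoszul (lengthGrading ρ) where
  gradedQuiverAlgebra := isGradedQuiverAlgebra_lengthGrading hρ
  quasiKoszul :=
    { noetherian_left := isNoetherian_of_tower K inferInstance
      noetherian_right := isNoetherian_of_tower K inferInstance
      semiperfect := isSemiperfect hρ
      generated := h }

end Quadratic

end QuiverAlgebra

/-! ### Deck transformations of coverings of quivers -/

section Covering

variable {V' V : Type*} [Quiver V'] [Quiver V]

/-- The action of a morphism of quivers on arrows. -/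
def Prefunctor.mapTotal (F : V' ⥤q V) (a : Quiver.Total V') : Quiver.Total V :=
  ⟨_, _, F.map a.hom⟩

namespace Prefunctor.IsCovering

variable {F : V' ⥤q V}

/-- Bundling arrows with their endpoints lets unique lifting be stated without transport along
equalities of vertices. -/
theorem total_eq_of_left (hF : F.IsCovering) {a b : Quiver.Total V'} (h : a.left = b.left)
    (hab : F.mapTotal a = F.mapTotal b) : a = b := by
  obtain ⟨s, t, a⟩ := a
  obtain ⟨s', t', b⟩ := b
  dsimp only at h
  subst h
  simp only [mapTotal, Quiver.Total.mk.injEq, true_and] at hab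
  have := (hF.star_bijective s).1 (a₁ := ⟨t, a⟩) (a₂ := ⟨t', b⟩) (Sigma.ext hab.1 hab.2)
  cases this
  rfl

theorem total_eq_of_right (hF : F.IsCovering) {a b : Quiver.Total V'} (h : a.right = b.right)
    (hab : F.mapTotal a = F.mapTotal b) : a = b := by
  obtain ⟨s, t, a⟩ := a
  obtain ⟨s', t', b⟩ := b
  dsimp only at h
  subst h
  simp only [mapTotal, Quiver.Total.mk.injEq, true_and] at hab
  have := (hF.costar_bijective t).1 (a₁ := ⟨s, a⟩) (a₂ := ⟨s', b⟩) (Sigma.ext hab.1 hab.2)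
  cases this
  rfl

theorem exists_total_left (hF : F.IsCovering) (a : Quiver.Total V) {x : V'}
    (hx : F.obj x = a.left) : ∃ b : Quiver.Total V', b.left = x ∧ F.mapTotal b = a := by
  obtain ⟨s, t, a⟩ := a
  dsimp only at hx
  subst hx
  obtain ⟨⟨y, b⟩, hb⟩ := (hF.star_bijective x).2 ⟨t, a⟩
  obtain ⟨rfl, h⟩ := Sigma.mk.inj_iff.1 hb
  exact ⟨⟨x, y, b⟩, rfl, by rw [mapTotal, eq_of_heq h]⟩

theorem exists_total_right (hF : F.IsCovering) (a : Quiver.Total V) {y : V'}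
    (hy : F.obj y = a.right) : ∃ b : Quiver.Total V', b.right = y ∧ F.mapTotal b = a := by
  obtain ⟨s, t, a⟩ := a
  dsimp only at hy
  subst hy
  obtain ⟨⟨x, b⟩, hb⟩ := (hF.costar_bijective y).2 ⟨s, a⟩
  obtain ⟨rfl, h⟩ := Sigma.mk.inj_iff.1 hb
  exact ⟨⟨x, y, b⟩, rfl, by rw [mapTotal, eq_of_heq h]⟩

theorem mapTotal_right {a : Quiver.Total V'} {b : Quiver.Total V} (h : F.mapTotal a = b) :
    F.obj a.right = b.right := h ▸ rfl

theorem mapTotal_left {a : Quiver.Total V'} {b : Quiver.Total V} (h : F.mapTotal a = b) :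
    F.obj a.left = b.left := h ▸ rfl

end Prefunctor.IsCovering

open Prefunctor.IsCovering

/-- The fibre of a morphism of quivers over a vertex. -/
abbrev Prefunctor.Fibre (F : V' ⥤q V) (v : V) : Type _ := {x : V' // F.obj x = v}

/-- Transport in the fibres of a covering along an arrow. -/
def Prefunctor.IsCovering.arrowTransport {F : V' ⥤q V} (hF : F.IsCovering) {v w : V} (e : v ⟶ w) :
    F.Fibre v ≃ F.Fibre w where
  toFun x := ⟨(hF.exists_total_left ⟨v, w, e⟩ x.2).choose.right,
    mapTotal_right (hF.exists_total_left ⟨v, w, e⟩ x.2).choose_spec.2⟩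
  invFun y := ⟨(hF.exists_total_right ⟨v, w, e⟩ y.2).choose.left,
    mapTotal_left (hF.exists_total_right ⟨v, w, e⟩ y.2).choose_spec.2⟩
  left_inv x := by
    apply Subtype.ext
    have h1 := hF.exists_total_left ⟨v, w, e⟩ x.2
    have h2 := hF.exists_total_right ⟨v, w, e⟩ (mapTotal_right h1.choose_spec.2)
    have : h2.choose = h1.choose :=
      hF.total_eq_of_right h2.choose_spec.1 (h2.choose_spec.2.trans h1.choose_spec.2.symm)
    exact (congrArg Quiver.Total.left this).trans h1.choose_spec.1
  right_inv y := by
    apply Subtype.ext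
    have h1 := hF.exists_total_right ⟨v, w, e⟩ y.2
    have h2 := hF.exists_total_left ⟨v, w, e⟩ (mapTotal_left h1.choose_spec.2)
    have : h2.choose = h1.choose :=
      hF.total_eq_of_left h2.choose_spec.1 (h2.choose_spec.2.trans h1.choose_spec.2.symm)
    exact (congrArg Quiver.Total.right this).trans h1.choose_spec.1

theorem Prefunctor.IsCovering.exists_total_arrowTransport {F : V' ⥤q V} (hF : F.IsCovering)
    {v w : V} (e : v ⟶ w) (x : F.Fibre v) : ∃ a : Quiver.Total V', a.left = x ∧
      a.right = hF.arrowTransport e x ∧ F.mapTotal a = ⟨v, w, e⟩ :=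
  ⟨_, (hF.exists_total_left ⟨v, w, e⟩ x.2).choose_spec.1, rfl,
    (hF.exists_total_left ⟨v, w, e⟩ x.2).choose_spec.2⟩

theorem Prefunctor.IsCovering.arrowTransport_map {F : V' ⥤q V} (hF : F.IsCovering)
    {x y : V'} (e : x ⟶ y) : hF.arrowTransport (F.map e) ⟨x, rfl⟩ = ⟨y, rfl⟩ := by
  obtain ⟨a, h1, h2, h3⟩ := hF.exists_total_arrowTransport (F.map e) ⟨x, rfl⟩
  have : a = ⟨x, y, e⟩ := hF.total_eq_of_left h1 h3
  subst this
  exact Subtype.ext h2.symm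

/-- The vertices of the base, as the objects of the groupoid of fibres. -/
structure FibreGroupoid (F : V' ⥤q V) where
  /-- the underlying vertex -/
  vertex : V

instance (F : V' ⥤q V) : Groupoid (FibreGroupoid F) where
  Hom v w := F.Fibre v.vertex ≃ F.Fibre w.vertex
  id _ := Equiv.refl _
  comp f g := f.trans g
  inv f := f.symm
  inv_comp f := f.symm_trans_self
  comp_inv f := f.self_trans_symm

/-- The monodromy functor of a covering of quivers. -/
def Prefunctor.IsCovering.monodromy {F : V' ⥤q V} (hF : F.IsCovering) :
    Quiver.FreeGroupoid V ⥤ FibreGroupoid F :=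
  Quiver.FreeGroupoid.lift ⟨fun v => ⟨v⟩, fun e => hF.arrowTransport e⟩

/-- Transport in the fibres along a homotopy class of unoriented paths. -/
def Prefunctor.IsCovering.transport {F : V' ⥤q V} (hF : F.IsCovering) {v w : V}
    (α : (Quiver.FreeGroupoid.of V).obj v ⟶ (Quiver.FreeGroupoid.of V).obj w) :
    F.Fibre v ≃ F.Fibre w :=
  hF.monodromy.map α

theorem Prefunctor.IsCovering.transport_id {F : V' ⥤q V} (hF : F.IsCovering) (v : V) :
    hF.transport (𝟙 ((Quiver.FreeGroupoid.of V).obj v)) = Equiv.refl _ :=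
  hF.monodromy.map_id _

theorem Prefunctor.IsCovering.transport_comp {F : V' ⥤q V} (hF : F.IsCovering) {u v w : V}
    (α : (Quiver.FreeGroupoid.of V).obj u ⟶ (Quiver.FreeGroupoid.of V).obj v)
    (β : (Quiver.FreeGroupoid.of V).obj v ⟶ (Quiver.FreeGroupoid.of V).obj w) :
    hF.transport (α ≫ β) = (hF.transport α).trans (hF.transport β) :=
  hF.monodromy.map_comp _ _

theorem Prefunctor.IsCovering.transport_inv {F : V' ⥤q V} (hF : F.IsCovering) {v w : V}
    (α : (Quiver.FreeGroupoid.of V).obj v ⟶ (Quiver.FreeGroupoid.of V).obj w) :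
    hF.transport (Groupoid.inv α) = (hF.transport α).symm := by
  have h := hF.transport_comp α (Groupoid.inv α)
  rw [Groupoid.comp_inv, transport_id] at h
  ext y
  have := congrArg (fun f => f ((hF.transport α).symm y)) h
  simpa using congrArg Subtype.val this.symm

theorem Prefunctor.IsCovering.transport_of {F : V' ⥤q V} (hF : F.IsCovering) {v w : V}
    (e : v ⟶ w) : hF.transport ((Quiver.FreeGroupoid.of V).map e) = hF.arrowTransport e :=
  Category.id_comp (obj := FibreGroupoid F) (X := ⟨v⟩) (Y := ⟨w⟩) (hF.arrowTransport e)

theorem Quiver.FreeGroupoid.hom_induction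
    {P : ∀ {x y : V}, ((Quiver.FreeGroupoid.of V).obj x ⟶ (Quiver.FreeGroupoid.of V).obj y) → Prop}
    (h_id : ∀ x, P (𝟙 ((Quiver.FreeGroupoid.of V).obj x)))
    (h_comp : ∀ {x y z : V} (α : (Quiver.FreeGroupoid.of V).obj x ⟶ (Quiver.FreeGroupoid.of V).obj y)
      (e : y ⟶ z), P α → P (α ≫ (Quiver.FreeGroupoid.of V).map e))
    (h_inv : ∀ {x y z : V} (α : (Quiver.FreeGroupoid.of V).obj x ⟶ (Quiver.FreeGroupoid.of V).obj y)
      (e : z ⟶ y), P α → P (α ≫ Groupoid.inv ((Quiver.FreeGroupoid.of V).map e)))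
    {x y : V} (α : (Quiver.FreeGroupoid.of V).obj x ⟶ (Quiver.FreeGroupoid.of V).obj y) : P α := by
  obtain ⟨p, rfl⟩ := Quot.exists_rep α
  change Quiver.Path (V := Quiver.Symmetrify V) x y at p
  induction p with
  | nil => exact h_id x
  | cons p e ih =>
    rcases e with e | e
    · exact h_comp _ e ih
    · exact h_inv _ e ih

/-- Transport in the fibres along the image of a homotopy class of unoriented paths. -/
def Prefunctor.IsCovering.transportMap {F : V' ⥤q V} (hF : F.IsCovering) {x y : V'}
    (α : (Quiver.FreeGroupoid.of V').obj x ⟶ (Quiver.FreeGroupoid.of V').obj y) :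
    F.Fibre (F.obj x) ≃ F.Fibre (F.obj y) :=
  (Quiver.freeGroupoidFunctor F ⋙ hF.monodromy).map α

namespace Prefunctor.IsCovering

variable {F : V' ⥤q V} (hF : F.IsCovering)

theorem transportMap_id (x : V') :
    hF.transportMap (𝟙 ((Quiver.FreeGroupoid.of V').obj x)) = Equiv.refl _ :=
  (Quiver.freeGroupoidFunctor F ⋙ hF.monodromy).map_id _

theorem transportMap_comp {x y z : V'}
    (α : (Quiver.FreeGroupoid.of V').obj x ⟶ (Quiver.FreeGroupoid.of V').obj y)
    (β : (Quiver.FreeGroupoid.of V').obj y ⟶ (Quiver.FreeGroupoid.of V').obj z) :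
    hF.transportMap (α ≫ β) = (hF.transportMap α).trans (hF.transportMap β) :=
  (Quiver.freeGroupoidFunctor F ⋙ hF.monodromy).map_comp _ _

theorem transportMap_inv {x y : V'}
    (α : (Quiver.FreeGroupoid.of V').obj x ⟶ (Quiver.FreeGroupoid.of V').obj y) :
    hF.transportMap (Groupoid.inv α) = (hF.transportMap α).symm := by
  have h := hF.transportMap_comp α (Groupoid.inv α)
  rw [Groupoid.comp_inv, transportMap_id] at h
  ext z
  have := congrArg (fun f => f ((hF.transportMap α).symm z)) h
  simpa using congrArg Subtype.val this.symm

theorem transportMap_of {x y : V'} (e : x ⟶ y) :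
    hF.transportMap ((Quiver.FreeGroupoid.of V').map e) = hF.arrowTransport (F.map e) := by
  have h : (Quiver.freeGroupoidFunctor F).map ((Quiver.FreeGroupoid.of V').map e) =
    (Quiver.FreeGroupoid.of V).map (F.map e) := Category.id_comp _
  exact (congrArg hF.monodromy.map h).trans (hF.transport_of (F.map e))

/-- The lift at `x` of the image of `α` is `α` itself, which ends at `y`. -/
theorem transportMap_apply_self {x y : V'}
    (α : (Quiver.FreeGroupoid.of V').obj x ⟶ (Quiver.FreeGroupoid.of V').obj y) :
    hF.transportMap α ⟨x, rfl⟩ = ⟨y, rfl⟩ := by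
  induction α using Quiver.FreeGroupoid.hom_induction with
  | h_id x => rw [transportMap_id, Equiv.refl_apply]
  | h_comp α e ih =>
    rw [transportMap_comp, Equiv.trans_apply, ih, transportMap_of, arrowTransport_map]
  | h_inv α e ih =>
    rw [transportMap_comp, Equiv.trans_apply, ih, transportMap_inv, transportMap_of,
      Equiv.symm_apply_eq, arrowTransport_map]

end Prefunctor.IsCovering

theorem IsConnectedQuiver.nonempty_hom (h : IsConnectedQuiver V) (x y : V) :
    Nonempty ((Quiver.FreeGroupoid.of V).obj x ⟶ (Quiver.FreeGroupoid.of V).obj y) :=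
  (h.2 x y).map fun p => Quot.mk _ p

theorem Prefunctor.mapTotal_congr {F G : V' ⥤q V} (h : F = G) (a : Quiver.Total V') :
    F.mapTotal a = G.mapTotal a := by rw [h]

theorem Prefunctor.ext_of_mapTotal {F G : V' ⥤q V} (h : ∀ x, F.obj x = G.obj x)
    (ha : ∀ a, F.mapTotal a = G.mapTotal a) : F = G := by
  obtain ⟨f, f'⟩ := F
  obtain ⟨g, g'⟩ := G
  have : f = g := funext h
  subst this
  congr
  ext x y e
  simpa [mapTotal] using ha ⟨x, y, e⟩

/-- A morphism over the base of a covering with connected total quiver that fixes a vertex is the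
identity. -/
theorem Prefunctor.IsCovering.eq_id_of_fixed {F : V' ⥤q V} (hF : F.IsCovering)
    (hconn : IsConnectedQuiver V') {g : V' ⥤q V'} (hg : g ⋙q F = F) {x₀ : V'}
    (h₀ : g.obj x₀ = x₀) : g = 𝟭q V' := by
  have hcomm : ∀ a, F.mapTotal (g.mapTotal a) = F.mapTotal a := Prefunctor.mapTotal_congr hg
  -- Being fixed propagates along arrows in both directions: `g e` and `e` lie over the same arrow
  -- and share an endpoint.
  have key : ∀ x y (_ : Quiver.Path (V := Quiver.Symmetrify V') x y), g.obj x = x →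
      g.obj y = y := by
    intro x y p hx
    induction p with
    | nil => exact hx
    | cons p e ih =>
      rcases e with e | e
      · exact congrArg Quiver.Total.right
          (hF.total_eq_of_left (a := g.mapTotal ⟨_, _, e⟩) (b := ⟨_, _, e⟩) ih (hcomm _))
      · exact congrArg Quiver.Total.left
          (hF.total_eq_of_right (a := g.mapTotal ⟨_, _, e⟩) (b := ⟨_, _, e⟩) ih (hcomm _))
  have hobj : ∀ x, g.obj x = x := fun x => key x₀ x (hconn.2 x₀ x).some h₀
  exact Prefunctor.ext_of_mapTotal hobj fun a => hF.total_eq_of_left (hobj a.left) (hcomm a)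

/-! ### Transitivity of the deck group and finiteness of the fibres -/

namespace IsRegularCovering

variable {F : V' ⥤q V} (hF : IsRegularCovering F)
include hF

/-- Loops lifting to a closed path at one point of a fibre lift to a closed path at any other. -/
theorem transportMap_loop {x y : V'} (h : F.obj x = F.obj y)
    (β : (Quiver.FreeGroupoid.of V').obj x ⟶ (Quiver.FreeGroupoid.of V').obj x) :
    hF.covering.transportMap β ⟨y, h.symm⟩ = ⟨y, h.symm⟩ := by
  obtain ⟨γ⟩ := hF.connected.nonempty_hom x y
  -- The image of a path from `x` to `y` is a loop in the base, and transport along it takes `x` to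
  -- `y`.
  let c : QuiverPi1 (F.obj x) :=
    (Quiver.freeGroupoidFunctor F).map γ ≫ eqToHom (by rw [h]; rfl)
  have hc : hF.covering.transport c ⟨x, rfl⟩ = ⟨y, h.symm⟩ := by
    have h1 := hF.covering.transportMap_apply_self γ
    have h2 : ∀ (w : V) (hw : F.obj y = w) (d : (Quiver.FreeGroupoid.of V).obj (F.obj x) ⟶
        (Quiver.FreeGroupoid.of V).obj (F.obj y)), hF.covering.transport d ⟨x, rfl⟩ = ⟨y, rfl⟩ →
        hF.covering.transport (w := w) (d ≫ eqToHom (by rw [hw])) ⟨x, rfl⟩ = ⟨y, hw⟩ := by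
      rintro w rfl d hd
      rw [eqToHom_refl, Category.comp_id, hd]
    exact h2 _ h.symm _ h1
  -- By normality the conjugate of the image of `β` by `c` is again the image of a loop at `x`,
  -- hence fixes `x`. So the image of `β` fixes `y`, the transport of `x` along `c`.
  have hn := (hF.normal x).conj_mem _ ⟨β, rfl⟩ c
  obtain ⟨δ, hδ⟩ := hn
  have hd : hF.covering.transport (c * (F.mapPi1 x) β * c⁻¹) ⟨x, rfl⟩ = ⟨x, rfl⟩ := by
    rw [← hδ]
    exact hF.covering.transportMap_apply_self δ
  have hmul : ∀ a b : QuiverPi1 (F.obj x), hF.covering.transport (a * b) =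
      (hF.covering.transport a).trans (hF.covering.transport b) :=
    fun a b => hF.covering.transport_comp a b
  have hinv : hF.covering.transport (c⁻¹ : QuiverPi1 (F.obj x)) =
      (hF.covering.transport c).symm := hF.covering.transport_inv c
  rw [hmul, hmul, hinv, Equiv.trans_apply, Equiv.trans_apply, Equiv.symm_apply_eq, hc] at hd
  exact hd

/-- Independence of the path is what makes the deck transformation `x₀ ↦ y₀` well defined. -/
theorem transportMap_eq {x y z : V'} (h : F.obj x = F.obj y)
    (γ γ' : (Quiver.FreeGroupoid.of V').obj x ⟶ (Quiver.FreeGroupoid.of V').obj z) :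
    hF.covering.transportMap γ ⟨y, h.symm⟩ = hF.covering.transportMap γ' ⟨y, h.symm⟩ := by
  have h1 := hF.transportMap_loop h (γ ≫ Groupoid.inv γ')
  rwa [hF.covering.transportMap_comp, Equiv.trans_apply, hF.covering.transportMap_inv,
    Equiv.symm_apply_eq] at h1

/-- Two points of a fibre of a regular covering are related by a morphism over the base. -/
theorem exists_prefunctor {x₀ y₀ : V'} (h : F.obj x₀ = F.obj y₀) :
    ∃ g : V' ⥤q V', g ⋙q F = F ∧ g.obj x₀ = y₀ := by
  let γ (x : V') := (hF.connected.nonempty_hom x₀ x).some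
  -- The image of `x` must be the endpoint of the lift, starting at `y₀`, of a path from `x₀` to
  -- `x`.
  let t (x : V') : F.Fibre (F.obj x) := hF.covering.transportMap (γ x) ⟨y₀, h.symm⟩
  have ht : ∀ {x y : V'} (e : x ⟶ y), hF.covering.arrowTransport (F.map e) (t x) = t y := by
    intro x y e
    have h1 := hF.transportMap_eq h (γ y) (γ x ≫ (Quiver.FreeGroupoid.of V').map e)
    rw [hF.covering.transportMap_comp, Equiv.trans_apply, hF.covering.transportMap_of] at h1
    exact h1.symm
  have hlift : ∀ {x y : V'} (e : x ⟶ y), ∃ a : (t x : V') ⟶ t y,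
      F.mapTotal ⟨_, _, a⟩ = ⟨_, _, F.map e⟩ := by
    intro x y e
    obtain ⟨⟨l, r, a⟩, h1, h2, h3⟩ := hF.covering.exists_total_arrowTransport (F.map e) (t x)
    rw [ht] at h2
    dsimp only at h1 h2
    subst h1 h2
    exact ⟨a, h3⟩
  choose a ha using @hlift
  refine ⟨⟨fun x => t x, fun e => a e⟩, ?_, ?_⟩
  · exact Prefunctor.ext_of_mapTotal (fun x => (t x).2) fun b => ha b.hom
  · have h1 := hF.transportMap_eq h (γ x₀) (𝟙 _)
    rw [hF.covering.transportMap_id] at h1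
    exact congrArg Subtype.val h1

/-- The group of deck transformations of a regular covering is transitive on fibres. -/
theorem exists_coveringAut {x₀ y₀ : V'} (h : F.obj x₀ = F.obj y₀) :
    ∃ g : CoveringAut F, g.hom.obj x₀ = y₀ := by
  obtain ⟨g, hg, hg₀⟩ := hF.exists_prefunctor h
  obtain ⟨k, hk, hk₀⟩ := hF.exists_prefunctor h.symm
  refine ⟨⟨g, k, ?_, ?_, hg⟩, hg₀⟩
  -- The composites lie over the base and fix a vertex, so they are identities.
  · refine hF.covering.eq_id_of_fixed hF.connected (x₀ := x₀) ?_ ?_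
    · rw [Prefunctor.comp_assoc, hk, hg]
    · rw [Prefunctor.comp_obj, hg₀, hk₀]
  · refine hF.covering.eq_id_of_fixed hF.connected (x₀ := y₀) ?_ ?_
    · rw [Prefunctor.comp_assoc, hg, hk]
    · rw [Prefunctor.comp_obj, hk₀, hg₀]

/-- Automorphisms carrying a fixed point of the fibre to its various points are distinct. -/
theorem finite_fibre [Finite (CoveringAut F)] (v : V) : Finite (F.Fibre v) := by
  rcases isEmpty_or_nonempty (F.Fibre v) with _ | ⟨⟨x₀, hx₀⟩⟩
  · infer_instance
  · choose g hg using fun y : F.Fibre v => hF.exists_coveringAut (hx₀.trans y.2.symm)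
    refine Finite.of_injective g fun y z hyz => Subtype.ext ?_
    rw [← hg y, ← hg z, hyz]

theorem finite_total [Finite V] [Finite (CoveringAut F)] : Finite V' := by
  have := hF.finite_fibre
  exact Finite.of_equiv _ (Equiv.sigmaFiberEquiv F.obj)

end IsRegularCovering

end Covering

/-! ### The algebra of a covering as an extension of the algebra of the base -/

section PathLifting

open PathAlgebra

namespace QuiverPath

variable {V' V : Type*} [Quiver V'] [Quiver V] (F : V' ⥤q V)

theorem length_map (p : QuiverPath V') : (p.map F).length = p.length := by
  obtain ⟨s, t, p⟩ := p
  change (F.mapPath p).length = p.length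
  induction p with
  | nil => rfl
  | cons p e ih => simp [Prefunctor.mapPath_cons, ih]

theorem map_concat (p q : QuiverPath V') (h : q.target = p.source) :
    (p.concat q h).map F = (p.map F).concat (q.map F) (congrArg F.obj h) := by
  obtain ⟨s, t, p⟩ := p
  obtain ⟨s', t', q⟩ := q
  dsimp only at h
  subst h
  simp [map, concat]

end QuiverPath

variable {K : Type*} [Field K] {V' V : Type*} [Quiver V'] [Quiver V] {F : V' ⥤q V}

namespace Prefunctor.IsCovering

variable (hF : F.IsCovering)

open Classical in
/-- The lift of a path with initial vertex `x`, and zero if there is none. -/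
def pathLift (K : Type*) [Field K] (p : QuiverPath V) (x : V') : PathAlgebra K V' :=
  if h : F.obj x = p.source then ofPath (hF.existsUnique_lift p x h).choose else 0

theorem pathLift_map (p' : QuiverPath V') : hF.pathLift K (p'.map F) p'.source = ofPath p' := by
  have h := hF.existsUnique_lift (p'.map F) p'.source rfl
  refine (dif_pos (c := F.obj p'.source = (p'.map F).source) rfl).trans (congrArg ofPath ?_)
  exact h.unique h.choose_spec.1 ⟨rfl, rfl⟩

theorem pathLift_of_ne {p : QuiverPath V} {x : V'} (h : F.obj x ≠ p.source) :
    hF.pathLift K p x = 0 := dif_neg h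

include hF in
theorem exists_path {p : QuiverPath V} {x : V'} (h : F.obj x = p.source) :
    ∃ p' : QuiverPath V', p'.source = x ∧ p'.map F = p :=
  (hF.existsUnique_lift p x h).exists

variable [Fintype V']

/-- The sum of all lifts of a path. -/
def pathLiftSum (K : Type*) [Field K] (p : QuiverPath V) : PathAlgebra K V' :=
  ∑ x, hF.pathLift K p x

theorem pathLiftSum_mul_ofPath (p : QuiverPath V) (q' : QuiverPath V') :
    hF.pathLiftSum K p * ofPath q' = hF.pathLift K p q'.target * ofPath q' := by
  rw [pathLiftSum, Finset.sum_mul, Finset.sum_eq_single q'.target]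
  · intro x _ hx
    by_cases h : F.obj x = p.source
    · obtain ⟨p', rfl, rfl⟩ := hF.exists_path h
      rw [pathLift_map, ofPath_mul_ofPath_of_ne hx.symm]
    · rw [hF.pathLift_of_ne h, zero_mul]
  · simp

variable [Fintype V]

/-- The homomorphism of path algebras sending a path to the sum of its lifts. -/
def liftHom (K : Type*) [Field K] : PathAlgebra K V →ₐ[K] PathAlgebra K V' :=
  liftAlgHom (hF.pathLiftSum K)
    -- Each vertex of `Q'` lies over exactly one vertex of `Q`, so the lifts of all trivial paths
    -- add up to `1`.
    (by
      simp only [pathLiftSum]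
      rw [Finset.sum_comm, PathAlgebra.one_eq_sum]
      refine Finset.sum_congr rfl fun x _ => ?_
      rw [Finset.sum_eq_single (F.obj x)]
      · exact hF.pathLift_map (QuiverPath.trivial x)
      · intro v _ hv
        exact hF.pathLift_of_ne hv.symm
      · simp)
    (fun p q h => by
      rw [pathLiftSum, pathLiftSum.eq_1 hF K q, Finset.mul_sum]
      refine Finset.sum_congr rfl fun x _ => ?_
      by_cases hx : F.obj x = q.source
      · obtain ⟨q', rfl, rfl⟩ := hF.exists_path hx
        -- The lift of the concatenation at `x` is the lift of `q` at `x` followed by the lift of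
        -- `p` where that one ends; the other lifts of `p` are not composable with it.
        obtain ⟨p', hp', rfl⟩ := hF.exists_path (x := q'.target) h
        rw [pathLift_map, pathLiftSum_mul_ofPath, ← hp', pathLift_map,
          ofPath_mul_ofPath hp'.symm, ← hF.pathLift_map, QuiverPath.map_concat]
        rfl
      · rw [hF.pathLift_of_ne hx, mul_zero]
        exact hF.pathLift_of_ne hx)
    (fun p q h => by
      rw [pathLiftSum.eq_1 hF K q, Finset.mul_sum]
      refine Finset.sum_eq_zero fun x _ => ?_
      by_cases hx : F.obj x = q.source
      · obtain ⟨q', rfl, rfl⟩ := hF.exists_path hx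
        rw [pathLift_map, pathLiftSum_mul_ofPath, hF.pathLift_of_ne h, zero_mul]
      · rw [hF.pathLift_of_ne hx, mul_zero])

theorem liftHom_ofPath (p : QuiverPath V) : hF.liftHom K (ofPath p) = hF.pathLiftSum K p :=
  liftAlgHom_ofPath _ _ _ _ p

end Prefunctor.IsCovering

/-! ### Projection and components as linear maps -/

namespace PathAlgebra

/-- The linear map of path algebras induced by a morphism of quivers. -/
def mapLinear (K : Type*) [Field K] (F : V' ⥤q V) : PathAlgebra K V' →ₗ[K] PathAlgebra K V :=
  liftLinear fun p => ofPath (p.map F)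

theorem liftLinear_ofPath_comp_eq {W W' : Type*} [Quiver W] [Quiver W']
    (f : QuiverPath W → QuiverPath W') (x : PathAlgebra K W) :
    liftLinear (fun p => (ofPath (f p) : PathAlgebra K W')) x =
      ofCoeff (Finsupp.mapDomain f x.coeff) :=
  Finset.sum_congr rfl fun p _ => (Finsupp.smul_single _ _ _).trans (by
    rw [smul_eq_mul, mul_one]; rfl)

theorem map_eq_mapLinear (x : PathAlgebra K V') : map F x = mapLinear K F x :=
  (liftLinear_ofPath_comp_eq _ x).symm

theorem mapLinear_ofPath (p : QuiverPath V') :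
    mapLinear K F (ofPath p) = ofPath (p.map F) := liftLinear_ofPath _ _

open Classical in
/-- The component of a linear combination of paths, as a linear map. -/
def componentLinear (K : Type*) [Field K] (v w : V) : PathAlgebra K V →ₗ[K] PathAlgebra K V :=
  liftLinear fun p => if p.source = v ∧ p.target = w then ofPath p else 0

open Classical in
theorem componentLinear_ofPath (v w : V) (p : QuiverPath V) : componentLinear K v w (ofPath p) =
    if p.source = v ∧ p.target = w then ofPath p else 0 := liftLinear_ofPath _ _

theorem component_eq_componentLinear (v w : V) (x : PathAlgebra K V) :
    component v w x = componentLinear K v w x := by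
  classical
  refine Finsupp.induction_linear (motive := fun y : QuiverPath V →₀ K =>
    component v w (ofCoeff y) = componentLinear K v w (ofCoeff y)) x ?_ ?_ ?_
  · rw [show (ofCoeff 0 : PathAlgebra K V) = 0 from rfl, map_zero]
    exact Finsupp.filter_zero _
  · intro f g hf hg
    rw [show ofCoeff (f + g) = (ofCoeff f + ofCoeff g : PathAlgebra K V) from rfl, map_add,
      ← hf, ← hg]
    exact Finsupp.filter_add
  · intro p c
    have h : ofCoeff (Finsupp.single p c) = c • (ofPath p : PathAlgebra K V) := by
      change Finsupp.single p c = c • Finsupp.single p (1 : K)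
      rw [Finsupp.smul_single, smul_eq_mul, mul_one]
    rw [h, map_smul, componentLinear_ofPath, ← h]
    split_ifs with hp
    · rw [← h]
      exact Finsupp.filter_single_of_pos _ hp
    · rw [smul_zero]
      exact Finsupp.filter_single_of_neg _ hp

theorem componentLinear_eq_mul [Finite V] (v w : V) (x : PathAlgebra K V) :
    componentLinear K v w x =
      ofPath (QuiverPath.trivial w) * x * ofPath (QuiverPath.trivial v) := by
  classical
  have h : componentLinear K v w = LinearMap.mulRight K (ofPath (QuiverPath.trivial v)) ∘ₗ
      LinearMap.mulLeft K (ofPath (QuiverPath.trivial w)) := by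
    refine hom_ext fun p => ?_
    rw [componentLinear_ofPath, LinearMap.comp_apply, LinearMap.mulLeft_apply,
      LinearMap.mulRight_apply]
    split_ifs with hp
    · obtain ⟨rfl, rfl⟩ := hp
      rw [ofPath_mul_ofPath rfl, QuiverPath.trivial_concat, ofPath_mul_ofPath rfl,
        QuiverPath.concat_trivial]
    · by_cases h : p.target = w
      · subst h
        rw [ofPath_mul_ofPath rfl, QuiverPath.trivial_concat, ofPath_mul_ofPath_of_ne]
        exact fun h => hp ⟨h.symm, rfl⟩
      · rw [ofPath_mul_ofPath_of_ne (p := QuiverPath.trivial w) h, zero_mul]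
  rw [h]
  rfl

theorem componentLinear_componentLinear_of_ne {v w v₁ w₁ : V} (h : ¬ (v₁ = v ∧ w₁ = w))
    (x : PathAlgebra K V) : componentLinear K v w (componentLinear K v₁ w₁ x) = 0 := by
  classical
  have key : componentLinear K v w ∘ₗ componentLinear K v₁ w₁ = 0 := by
    refine hom_ext fun p => ?_
    rw [LinearMap.comp_apply, componentLinear_ofPath]
    split_ifs with hp
    · obtain ⟨rfl, rfl⟩ := hp
      rw [componentLinear_ofPath, if_neg h, LinearMap.zero_apply]
    · rw [map_zero, LinearMap.zero_apply]
  exact LinearMap.congr_fun key x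

theorem ofPath_mul_mul_ofPath [Finite V] (p q : QuiverPath V) (x : PathAlgebra K V) :
    ofPath p * x * ofPath q =
      ofPath p * componentLinear K q.target p.source x * ofPath q := by
  have hp : (ofPath p : PathAlgebra K V) * ofPath (QuiverPath.trivial p.source) = ofPath p := by
    rw [ofPath_mul_ofPath rfl, QuiverPath.concat_trivial]
  have hq : (ofPath (QuiverPath.trivial q.target) : PathAlgebra K V) * ofPath q = ofPath q := by
    rw [ofPath_mul_ofPath rfl, QuiverPath.trivial_concat]
  rw [componentLinear_eq_mul]
  conv_lhs => rw [← hp, ← hq]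
  simp only [mul_assoc]

theorem mapLinear_ofPath_mul_ofPath [Finite V'] [Finite V] {p q : QuiverPath V'}
    (h : q.target = p.source) : mapLinear K F (ofPath p * ofPath q) =
      ofPath (p.map F) * ofPath (q.map F) := by
  rw [ofPath_mul_ofPath h, mapLinear_ofPath, QuiverPath.map_concat F p q h,
    ofPath_mul_ofPath (congrArg F.obj h)]

/-- The projection is not multiplicative, since paths that are not composable may have composable
images. Restricting the middle factor to one component makes every product composable. -/
theorem mapLinear_ofPath_mul_componentLinear_mul_ofPath [Finite V'] [Finite V]
    (p q : QuiverPath V') (x : PathAlgebra K V') :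
    mapLinear K F (ofPath p * componentLinear K q.target p.source x * ofPath q) =
      ofPath (p.map F) * mapLinear K F (componentLinear K q.target p.source x) *
        ofPath (q.map F) := by
  classical
  have key : mapLinear K F ∘ₗ LinearMap.mulRight K (ofPath q) ∘ₗ LinearMap.mulLeft K (ofPath p) ∘ₗ
        componentLinear K q.target p.source =
      LinearMap.mulRight K (ofPath (q.map F)) ∘ₗ LinearMap.mulLeft K (ofPath (p.map F)) ∘ₗ
        mapLinear K F ∘ₗ componentLinear K q.target p.source := by
    refine hom_ext fun s => ?_
    simp only [LinearMap.comp_apply, componentLinear_ofPath, LinearMap.mulLeft_apply,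
      LinearMap.mulRight_apply]
    split_ifs with hs
    · rw [ofPath_mul_ofPath hs.2, mapLinear_ofPath_mul_ofPath (p := p.concat s hs.2) hs.1.symm,
        ← mapLinear_ofPath (p.concat s hs.2), ← ofPath_mul_ofPath hs.2,
        mapLinear_ofPath_mul_ofPath hs.2, mapLinear_ofPath]
    · simp
  exact LinearMap.congr_fun key x

end PathAlgebra

open Prefunctor.IsCovering

section LiftRelation

variable (hF : F.IsCovering) {L : V → V'} (hL : IsLifting F L)

/-- The lifting of linear combinations of paths, as a linear map. -/
def liftRelationLinear (K : Type*) [Field K] : PathAlgebra K V →ₗ[K] PathAlgebra K V' :=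
  liftLinear fun p => ofPath (liftPath hF hL p)

theorem liftRelation_eq_liftRelationLinear (r : PathAlgebra K V) :
    liftRelation hF hL r = liftRelationLinear hF hL K r :=
  (liftLinear_ofPath_comp_eq _ r).symm

theorem liftRelationLinear_ofPath (p : QuiverPath V) :
    liftRelationLinear hF hL K (ofPath p) = ofPath (liftPath hF hL p) := liftLinear_ofPath _ _

theorem length_liftPath (p : QuiverPath V) : (liftPath hF hL p).length = p.length := by
  rw [← QuiverPath.length_map F, (liftPath_spec hF hL p).2]

theorem liftRelationLinear_mem_lengthPart {n : ℕ} {r : PathAlgebra K V}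
    (hr : r ∈ lengthPart K V n) : liftRelationLinear hF hL K r ∈ lengthPart K V' n := by
  have hle : lengthPart K V n ≤ (lengthPart K V' n).comap (liftRelationLinear hF hL K) := by
    refine Submodule.span_le.2 ?_
    rintro _ ⟨p, rfl, rfl⟩
    change liftRelationLinear hF hL K (ofPath p) ∈ lengthPart K V' p.length
    rw [liftRelationLinear_ofPath]
    exact Submodule.subset_span ⟨_, length_liftPath hF hL p, rfl⟩
  exact hle hr

theorem mapLinear_liftRelationLinear (r : PathAlgebra K V) :
    mapLinear K F (liftRelationLinear hF hL K r) = r := by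
  have key : mapLinear K F ∘ₗ liftRelationLinear hF hL K = LinearMap.id :=
    hom_ext fun p => by
      rw [LinearMap.comp_apply, liftRelationLinear_ofPath, mapLinear_ofPath,
        (liftPath_spec hF hL p).2, LinearMap.id_apply]
  exact LinearMap.congr_fun key r

theorem componentLinear_liftRelationLinear (v' w' : V') (r : PathAlgebra K V) :
    componentLinear K v' w' (liftRelationLinear hF hL K r) =
      componentLinear K v' w' (liftRelationLinear hF hL K
        (componentLinear K (F.obj v') (F.obj w') r)) := by
  classical
  have key : componentLinear K v' w' ∘ₗ liftRelationLinear hF hL K =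
      componentLinear K v' w' ∘ₗ liftRelationLinear hF hL K ∘ₗ
        componentLinear K (F.obj v') (F.obj w') := by
    refine hom_ext fun p => ?_
    simp only [LinearMap.comp_apply, componentLinear_ofPath, liftRelationLinear_ofPath]
    have hmap := (liftPath_spec hF hL p).2
    split_ifs with h1 h2 h2
    · rw [liftRelationLinear_ofPath, componentLinear_ofPath, if_pos h1]
    · refine absurd ?_ h2
      rw [← h1.1, ← h1.2]
      exact ⟨congrArg QuiverPath.source hmap.symm, congrArg QuiverPath.target hmap.symm⟩
    · rw [liftRelationLinear_ofPath, componentLinear_ofPath, if_neg h1]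
    · rw [map_zero, map_zero]
  exact LinearMap.congr_fun key r

/-- The paths occurring in `L(r)` are lifts along `L`, so projecting and lifting along the same `L`
returns them. -/
theorem liftRelationLinear_mapLinear_componentLinear (v' w' : V') (r : PathAlgebra K V) :
    liftRelationLinear hF hL K (mapLinear K F
        (componentLinear K v' w' (liftRelationLinear hF hL K r))) =
      componentLinear K v' w' (liftRelationLinear hF hL K r) := by
  classical
  have key : liftRelationLinear hF hL K ∘ₗ mapLinear K F ∘ₗ componentLinear K v' w' ∘ₗ
      liftRelationLinear hF hL K = componentLinear K v' w' ∘ₗ liftRelationLinear hF hL K := by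
    refine hom_ext fun p => ?_
    simp only [LinearMap.comp_apply, componentLinear_ofPath, liftRelationLinear_ofPath]
    split_ifs with h1
    · rw [mapLinear_ofPath, (liftPath_spec hF hL p).2, liftRelationLinear_ofPath]
    · rw [map_zero, map_zero]
  exact LinearMap.congr_fun key r

/-- The part of the lift of a relation starting at `x`. -/
theorem liftLinear_pathLift [Finite V'] {x : V'} (hx : L (F.obj x) = x) (r : PathAlgebra K V) :
    liftLinear (fun p => hF.pathLift K p x) r =
      liftRelationLinear hF hL K r * ofPath (QuiverPath.trivial x) := by
  have key : liftLinear (fun p => hF.pathLift K p x) =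
      LinearMap.mulRight K (ofPath (QuiverPath.trivial x)) ∘ₗ liftRelationLinear hF hL K := by
    refine hom_ext fun p => ?_
    rw [liftLinear_ofPath, LinearMap.comp_apply, liftRelationLinear_ofPath,
      LinearMap.mulRight_apply]
    obtain ⟨h1, h2⟩ := liftPath_spec hF hL p
    by_cases h : F.obj x = p.source
    · have h3 : (liftPath hF hL p).source = x := by rw [h1, ← h, hx]
      have h4 := hF.pathLift_map (K := K) (liftPath hF hL p)
      rw [h2, h3] at h4
      rw [h4, ofPath_mul_ofPath h3.symm]
      subst h3
      rw [QuiverPath.concat_trivial]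
    · rw [hF.pathLift_of_ne h, ofPath_mul_ofPath_of_ne]
      rintro (h' : x = _)
      apply h
      rw [h', h1, hL]
  exact LinearMap.congr_fun key r

end LiftRelation

end PathLifting

/-! ### Galois coverings: surjectivity, pushforward and pullback -/

section GaloisCovering

open PathAlgebra

variable {K : Type*} [Field K] {V' V : Type*} [Quiver V'] [Quiver V] {F : V' ⥤q V}

/-- Arrows lift from either end, so the image of a covering is closed under arrows in both
directions. -/
theorem Prefunctor.IsCovering.source_mem_range_iff (hF : F.IsCovering) (p : QuiverPath V) :
    p.source ∈ Set.range F.obj ↔ p.target ∈ Set.range F.obj := by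
  obtain ⟨s, t, p⟩ := p
  dsimp only
  induction p with
  | nil => rfl
  | cons p e ih =>
    rw [ih]
    constructor
    · rintro ⟨x, hx⟩
      obtain ⟨b, -, hb⟩ := hF.exists_total_left ⟨_, _, e⟩ hx
      exact ⟨b.right, congrArg Quiver.Total.right hb⟩
    · rintro ⟨x, hx⟩
      obtain ⟨b, -, hb⟩ := hF.exists_total_right ⟨_, _, e⟩ hx
      exact ⟨b.left, congrArg Quiver.Total.left hb⟩

/-- A covering of the quiver of a connected quadratic algebra is surjective on vertices. -/
theorem Prefunctor.IsCovering.obj_surjective [Finite V] [Nonempty V'] (hF : F.IsCovering)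
    {ρ : Set (PathAlgebra K V)} (hρ : IsQuadraticRelations ρ)
    (hconn : IsConnectedAlgebra (QuiverAlgebra ρ)) : Function.Surjective F.obj := by
  classical
  have := Fintype.ofFinite V
  -- The idempotent `e` is the sum of the trivial paths in the image of `F`. It is central because
  -- the source of a path lies in the image exactly when its target does.
  let χ : V → K := fun v => if v ∈ Set.range F.obj then 1 else 0
  let e := QuiverAlgebra.vertexHom ρ χ
  have hχ : χ * χ = χ := by
    ext v
    simp [χ]
  have hidem : IsIdempotentElem e := by
    rw [IsIdempotentElem, ← map_mul, hχ]
  have hleft : ∀ p, e * QuiverAlgebra.ofPath ρ p = χ p.target • QuiverAlgebra.ofPath ρ p := by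
    intro p
    simp only [e, QuiverAlgebra.vertexHom_apply, Finset.sum_mul]
    rw [Finset.sum_eq_single p.target]
    · rw [smul_mul_assoc, QuiverAlgebra.ofPath_mul_ofPath rfl, QuiverPath.trivial_concat]
    · intro v _ hv
      rw [smul_mul_assoc, QuiverAlgebra.ofPath_mul_ofPath_of_ne (by exact hv.symm), smul_zero]
    · simp
  have hright : ∀ p, QuiverAlgebra.ofPath ρ p * e = χ p.source • QuiverAlgebra.ofPath ρ p := by
    intro p
    simp only [e, QuiverAlgebra.vertexHom_apply, Finset.mul_sum]
    rw [Finset.sum_eq_single p.source]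
    · rw [mul_smul_comm, QuiverAlgebra.ofPath_mul_ofPath rfl, QuiverPath.concat_trivial]
    · intro v _ hv
      rw [mul_smul_comm, QuiverAlgebra.ofPath_mul_ofPath_of_ne (by exact hv), smul_zero]
    · simp
  have hcentral : ∀ a, e * a = a * e := by
    have key : LinearMap.mulLeft K e = LinearMap.mulRight K e := by
      refine QuiverAlgebra.linearMap_ext fun p => ?_
      rw [LinearMap.mulLeft_apply, LinearMap.mulRight_apply, hleft, hright]
      simp only [χ, hF.source_mem_range_iff p]
    exact fun a => LinearMap.congr_fun key a
  have haug : QuiverAlgebra.augmentation hρ e = χ := QuiverAlgebra.augmentation_vertexHom hρ χ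
  obtain ⟨x⟩ := ‹Nonempty V'›
  -- The augmentation recovers `χ` from `e`. It is nonzero at `F x`, so `e = 1` and `χ` is
  -- identically one.
  rcases hconn.2 e hidem hcentral with h | h
  · rw [h, map_zero] at haug
    have := congrFun haug (F.obj x)
    simp [χ] at this
  · rw [h, map_one] at haug
    intro v
    have := congrFun haug v
    by_contra hv
    simp [χ] at this
    exact hv this

theorem PathAlgebra.linearMap_mul_mul_eq_zero [Finite V] {M : Type*} [AddCommGroup M] [Module K M]
    (P : PathAlgebra K V →ₗ[K] M) {r : PathAlgebra K V}
    (h : ∀ p q, P (ofPath p * r * ofPath q) = 0) (a b : PathAlgebra K V) : P (a * r * b) = 0 := by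
  have h1 : ∀ p, P (ofPath p * r * b) = 0 := fun p =>
    LinearMap.congr_fun (hom_ext (f := P ∘ₗ LinearMap.mulLeft K (ofPath p * r)) (g := 0) (h p)) b
  exact LinearMap.congr_fun (hom_ext (f := P ∘ₗ LinearMap.mulRight K b ∘ₗ LinearMap.mulRight K r)
    (g := 0) h1) a

theorem QuiverAlgebra.mk_componentLinear_eq_zero [Finite V] {ρ : Set (PathAlgebra K V)}
    {r : PathAlgebra K V} (hr : r ∈ ρ) (v w : V) :
    QuiverAlgebra.mk ρ (componentLinear K v w r) = 0 := by
  rw [componentLinear_eq_mul, map_mul, map_mul, QuiverAlgebra.mk_eq_zero_of_mem hr, mul_zero,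
    zero_mul]

namespace IsGaloisCovering

variable {ρ' : Set (PathAlgebra K V')} {ρ : Set (PathAlgebra K V)} (hF : IsGaloisCovering F ρ' ρ)

include hF

theorem exists_eq_liftRelationLinear {r' : PathAlgebra K V'} (hr' : r' ∈ ρ') :
    ∃ (L : V → V') (hL : IsLifting F L), ∃ r ∈ ρ,
      r' = liftRelationLinear hF.regular.covering hL K r := by
  rw [hF.relations_eq] at hr'
  obtain ⟨L, hL, r, hr, rfl⟩ := hr'
  exact ⟨L, hL, r, hr, liftRelation_eq_liftRelationLinear _ _ _⟩

theorem liftRelationLinear_mem {L : V → V'} (hL : IsLifting F L) {r : PathAlgebra K V}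
    (hr : r ∈ ρ) : liftRelationLinear hF.regular.covering hL K r ∈ ρ' := by
  exact hF.relations_eq.ge ⟨L, hL, r, hr, (liftRelation_eq_liftRelationLinear _ _ _).symm⟩

theorem isQuadraticRelations (hρ : IsQuadraticRelations ρ) : IsQuadraticRelations ρ' := by
  intro r' hr'
  obtain ⟨L, hL, r, hr, rfl⟩ := hF.exists_eq_liftRelationLinear hr'
  exact liftRelationLinear_mem_lengthPart _ _ (hρ r hr)

/-- Let `r' = L(r)`. Condition (2) writes the component of `r` at `(F v', F w')` as the image of a
single component of `r'`. If that component sits at `(v', w')`, the claim is clear, since components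
of `r` lie in the ideal. Otherwise lifting back along `L` shows that the `(v', w')` component of
`r'` is zero. -/
theorem mk_mapLinear_componentLinear_eq_zero [Finite V] {r' : PathAlgebra K V'} (hr' : r' ∈ ρ')
    (v' w' : V') : QuiverAlgebra.mk ρ (mapLinear K F (componentLinear K v' w' r')) = 0 := by
  obtain ⟨v₁, w₁, h⟩ := hF.component_eq r' hr' (F.obj v') (F.obj w')
  rw [component_eq_componentLinear, component_eq_componentLinear, map_eq_mapLinear,
    map_eq_mapLinear] at h
  obtain ⟨L, hL, r, hr, rfl⟩ := hF.exists_eq_liftRelationLinear hr'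
  rw [mapLinear_liftRelationLinear] at h
  by_cases hvw : v₁ = v' ∧ w₁ = w'
  · obtain ⟨rfl, rfl⟩ := hvw
    rw [h]
    exact QuiverAlgebra.mk_componentLinear_eq_zero hr _ _
  · rw [componentLinear_liftRelationLinear, ← h, liftRelationLinear_mapLinear_componentLinear,
      componentLinear_componentLinear_of_ne hvw, map_zero, map_zero]

/-- Multiplying a relation by paths on both sides selects one of its components, so the lack of
multiplicativity of the projection does no harm. -/
theorem mk_mapLinear_eq_zero [Finite V] [Finite V'] {x : PathAlgebra K V'}
    (hx : x ∈ relationIdeal ρ') : QuiverAlgebra.mk ρ (mapLinear K F x) = 0 := by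
  have key : ∀ r' ∈ ρ', ∀ a b : PathAlgebra K V',
      QuiverAlgebra.mk ρ (mapLinear K F (a * r' * b)) = 0 := by
    intro r' hr' a b
    refine linearMap_mul_mul_eq_zero ((QuiverAlgebra.mk ρ).toLinearMap ∘ₗ mapLinear K F)
      (fun p q => ?_) a b
    change QuiverAlgebra.mk ρ (mapLinear K F (ofPath p * r' * ofPath q)) = 0
    rw [ofPath_mul_mul_ofPath, mapLinear_ofPath_mul_componentLinear_mul_ofPath, map_mul, map_mul,
      hF.mk_mapLinear_componentLinear_eq_zero hr', mul_zero, zero_mul]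
  have hx' : x ∈ TwoSidedIdeal.span ρ' := hx
  rw [TwoSidedIdeal.mem_span_iff_mem_addSubgroup_closure] at hx'
  refine AddSubgroup.closure_induction ?_ ?_ ?_ ?_ hx'
  · rintro _ ⟨_, ⟨a, -, r', hr', rfl⟩, b, -, rfl⟩
    exact key r' hr' a b
  · rw [map_zero, map_zero]
  · intro x y _ _ hx hy
    rw [map_add, map_add, hx, hy, add_zero]
  · intro x _ hx
    rw [map_neg, map_neg, hx, neg_zero]

/-- The map of algebras `KQ'/⟨ρ'⟩ → KQ/⟨ρ⟩` induced by a Galois covering. -/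
def pushforward [Finite V] [Finite V'] : QuiverAlgebra ρ' →ₗ[K] QuiverAlgebra ρ :=
  Submodule.liftQ ((relationIdeal ρ').restrictScalars K)
    ((QuiverAlgebra.mk ρ).toLinearMap ∘ₗ mapLinear K F)
    (fun _ hx => hF.mk_mapLinear_eq_zero hx) ∘ₗ
      (Submodule.Quotient.restrictScalarsEquiv K (relationIdeal ρ')).symm.toLinearMap

theorem pushforward_ofPath [Finite V] [Finite V'] (p : QuiverPath V') :
    hF.pushforward (QuiverAlgebra.ofPath ρ' p) = QuiverAlgebra.ofPath ρ (p.map F) := by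
  change QuiverAlgebra.mk ρ (mapLinear K F (ofPath p)) = _
  rw [mapLinear_ofPath]
  rfl

variable [Fintype V] [Fintype V'] (hsurj : Function.Surjective F.obj)

/-- Sorted by initial vertex `x`, the sum of all lifts of `r` splits into the parts `L(r) e_x`,
where `L` is any lifting through `x`. Such liftings exist because `F` is onto on vertices. -/
theorem mk_liftHom_eq_zero (hsurj : Function.Surjective F.obj) {r : PathAlgebra K V}
    (hr : r ∈ ρ) : QuiverAlgebra.mk ρ' (hF.regular.covering.liftHom K r) = 0 := by
  classical
  have key : (hF.regular.covering.liftHom K).toLinearMap =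
      ∑ x, liftLinear fun p => hF.regular.covering.pathLift K p x := by
    refine hom_ext fun p => ?_
    rw [LinearMap.sum_apply, AlgHom.toLinearMap_apply, Prefunctor.IsCovering.liftHom_ofPath]
    exact Finset.sum_congr rfl fun x _ =>
      (liftLinear_ofPath (fun p => hF.regular.covering.pathLift K p x) p).symm
  have h := LinearMap.congr_fun key r
  rw [AlgHom.toLinearMap_apply, LinearMap.sum_apply] at h
  rw [h, map_sum]
  refine Finset.sum_eq_zero fun x _ => ?_
  have hL : IsLifting F (Function.update (Function.surjInv hsurj) (F.obj x) x) := by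
    intro v
    by_cases hv : v = F.obj x
    · subst hv
      rw [Function.update_self]
    · rw [Function.update_of_ne hv, Function.surjInv_eq hsurj]
  rw [liftLinear_pathLift hF.regular.covering hL (Function.update_self _ _ _), map_mul,
    QuiverAlgebra.mk_eq_zero_of_mem (hF.liftRelationLinear_mem hL hr), zero_mul]

/-- The homomorphism `KQ/⟨ρ⟩ → KQ'/⟨ρ'⟩` sending a path to the sum of its lifts. -/
def pullback (hsurj : Function.Surjective F.obj) : QuiverAlgebra ρ →ₐ[K] QuiverAlgebra ρ' :=
  QuiverAlgebra.lift ((QuiverAlgebra.mk ρ').comp (hF.regular.covering.liftHom K))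
    fun _ hr => hF.mk_liftHom_eq_zero hsurj hr

theorem pullback_ofPath (p : QuiverPath V) : hF.pullback hsurj (QuiverAlgebra.ofPath ρ p) =
    QuiverAlgebra.mk ρ' (hF.regular.covering.pathLiftSum K p) := by
  change QuiverAlgebra.mk ρ' (hF.regular.covering.liftHom K (ofPath p)) = _
  rw [Prefunctor.IsCovering.liftHom_ofPath]

theorem pullback_ofPath_mul_ofPath (p : QuiverPath V) (q : QuiverPath V') :
    hF.pullback hsurj (QuiverAlgebra.ofPath ρ p) * QuiverAlgebra.ofPath ρ' q =
      QuiverAlgebra.mk ρ' (hF.regular.covering.pathLift K p q.target * ofPath q) := by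
  rw [pullback_ofPath, ← QuiverAlgebra.mk_ofPath, ← map_mul,
    Prefunctor.IsCovering.pathLiftSum_mul_ofPath]

theorem pullback_map_mul_trivial (p : QuiverPath V') :
    hF.pullback hsurj (QuiverAlgebra.ofPath ρ (p.map F)) *
      QuiverAlgebra.ofPath ρ' (QuiverPath.trivial p.source) = QuiverAlgebra.ofPath ρ' p := by
  rw [pullback_ofPath_mul_ofPath]
  change QuiverAlgebra.mk ρ' (hF.regular.covering.pathLift K (p.map F) p.source * _) = _
  rw [Prefunctor.IsCovering.pathLift_map, ofPath_mul_ofPath rfl, QuiverPath.concat_trivial]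
  rfl

/-- This projection formula is the `A`-linearity of the pushforward: only the lift of `p` starting
where `q` ends contributes, and its product with `q` lies over the product of `p` and the image of
`q`. -/
theorem pushforward_pullback_mul (a : QuiverAlgebra ρ) (b : QuiverAlgebra ρ') :
    hF.pushforward (hF.pullback hsurj a * b) = a * hF.pushforward b := by
  have key : ((LinearMap.mul K (QuiverAlgebra ρ')).compl₁₂ (hF.pullback hsurj).toLinearMap
      LinearMap.id).compr₂ hF.pushforward =
      (LinearMap.mul K (QuiverAlgebra ρ)).compl₁₂ LinearMap.id hF.pushforward := by
    refine QuiverAlgebra.linearMap_ext fun p => QuiverAlgebra.linearMap_ext fun q => ?_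
    change hF.pushforward (hF.pullback hsurj (QuiverAlgebra.ofPath ρ p) *
      QuiverAlgebra.ofPath ρ' q) = QuiverAlgebra.ofPath ρ p *
        hF.pushforward (QuiverAlgebra.ofPath ρ' q)
    rw [pullback_ofPath_mul_ofPath, pushforward_ofPath]
    by_cases h : F.obj q.target = p.source
    · obtain ⟨p', hp', rfl⟩ := hF.regular.covering.exists_path h
      rw [← hp', Prefunctor.IsCovering.pathLift_map, map_mul, QuiverAlgebra.mk_ofPath,
        QuiverAlgebra.mk_ofPath, QuiverAlgebra.ofPath_mul_ofPath hp'.symm, pushforward_ofPath,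
        QuiverPath.map_concat F p' q hp'.symm, QuiverAlgebra.ofPath_mul_ofPath h]
    · rw [hF.regular.covering.pathLift_of_ne h, zero_mul, map_zero, map_zero,
        QuiverAlgebra.ofPath_mul_ofPath_of_ne h]
  exact LinearMap.congr_fun (LinearMap.congr_fun key a) b

/-- The dual basis identity: for a path only the term at its initial vertex survives, and lifting
its image there gives the path back. -/
theorem sum_pullback_pushforward (b : QuiverAlgebra ρ') :
    ∑ x, hF.pullback hsurj
        (hF.pushforward (b * QuiverAlgebra.ofPath ρ' (QuiverPath.trivial x))) *
      QuiverAlgebra.ofPath ρ' (QuiverPath.trivial x) = b := by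
  have key : ∑ x, LinearMap.mulRight K (QuiverAlgebra.ofPath ρ' (QuiverPath.trivial x)) ∘ₗ
      (hF.pullback hsurj).toLinearMap ∘ₗ hF.pushforward ∘ₗ
        LinearMap.mulRight K (QuiverAlgebra.ofPath ρ' (QuiverPath.trivial x)) =
      LinearMap.id := by
    refine QuiverAlgebra.linearMap_ext fun p => ?_
    rw [LinearMap.sum_apply, Finset.sum_eq_single p.source]
    · simp only [LinearMap.comp_apply, LinearMap.mulRight_apply, AlgHom.toLinearMap_apply,
        LinearMap.id_apply]
      rw [QuiverAlgebra.ofPath_mul_ofPath rfl, QuiverPath.concat_trivial, pushforward_ofPath,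
        pullback_map_mul_trivial]
    · intro x _ hx
      simp only [LinearMap.comp_apply, LinearMap.mulRight_apply]
      rw [QuiverAlgebra.ofPath_mul_ofPath_of_ne (by exact hx), map_zero, map_zero, zero_mul]
    · simp
  have h := LinearMap.congr_fun key b
  rwa [LinearMap.sum_apply] at h

theorem pullback_mem_lengthGE {a : QuiverAlgebra ρ} {n : ℕ}
    (ha : a ∈ QuiverAlgebra.lengthGE ρ n) :
    hF.pullback hsurj a ∈ QuiverAlgebra.lengthGE ρ' n := by
  have hle : QuiverAlgebra.lengthGE ρ n ≤
      (QuiverAlgebra.lengthGE ρ' n).comap (hF.pullback hsurj).toLinearMap := by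
    refine QuiverAlgebra.lengthGE_le fun p hp => ?_
    change hF.pullback hsurj (QuiverAlgebra.ofPath ρ p) ∈ QuiverAlgebra.lengthGE ρ' n
    rw [pullback_ofPath, Prefunctor.IsCovering.pathLiftSum, map_sum]
    refine sum_mem fun x _ => ?_
    by_cases h : F.obj x = p.source
    · obtain ⟨p', rfl, rfl⟩ := hF.regular.covering.exists_path h
      rw [Prefunctor.IsCovering.pathLift_map]
      exact QuiverAlgebra.ofPath_mem_lengthGE (by rwa [QuiverPath.length_map] at hp)
    · rw [hF.regular.covering.pathLift_of_ne h, map_zero]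
      exact zero_mem _
  exact hle ha

/-- Koszulity passes to finite Galois coverings. -/
theorem isKoszul_lengthGrading [Nonempty V'] [Module.Finite K (QuiverAlgebra ρ)]
    (hρ : IsQuadraticRelations ρ) (hsurj : Function.Surjective F.obj)
    (h : ∀ i, extOnePow (QuiverAlgebra ρ) i = ⊤) : IsKoszul (lengthGrading ρ') := by
  have hρ' := hF.isQuadraticRelations hρ
  let := Module.compHom (QuiverAlgebra ρ') (hF.pullback hsurj).toRingHom
  have hsmul : ∀ (a : QuiverAlgebra ρ) (b : QuiverAlgebra ρ'), a • b = hF.pullback hsurj a * b :=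
    fun _ _ => rfl
  have : IsScalarTower (QuiverAlgebra ρ) (QuiverAlgebra ρ') (QuiverAlgebra ρ') :=
    ⟨fun a b c => by rw [hsmul, hsmul, smul_eq_mul, smul_eq_mul, mul_assoc]⟩
  have : IsScalarTower K (QuiverAlgebra ρ) (QuiverAlgebra ρ') :=
    ⟨fun k a b => by rw [hsmul, hsmul, map_smul, smul_mul_assoc]⟩
  let e (x : V') : QuiverAlgebra ρ' := QuiverAlgebra.ofPath ρ' (QuiverPath.trivial x)
  -- The dual basis presents `B` as a retract of the free `A`-module on the vertices of `Q'`.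
  let s : QuiverAlgebra ρ' →ₗ[QuiverAlgebra ρ] (V' → QuiverAlgebra ρ) :=
    { toFun := fun b x => hF.pushforward (b * e x)
      map_add' := fun b c => by
        ext x
        rw [add_mul, map_add, Pi.add_apply]
      map_smul' := fun a b => by
        ext x
        rw [hsmul, mul_assoc, pushforward_pullback_mul]
        rfl }
  let t : (V' → QuiverAlgebra ρ) →ₗ[QuiverAlgebra ρ] QuiverAlgebra ρ' :=
    ∑ x, (LinearMap.toSpanSingleton _ _ (e x)) ∘ₗ LinearMap.proj x
  have hts : t ∘ₗ s = LinearMap.id := by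
    refine LinearMap.ext fun b => ?_
    rw [LinearMap.comp_apply, LinearMap.sum_apply]
    exact hF.sum_pullback_pushforward hsurj b
  have : Module.Projective (QuiverAlgebra ρ) (QuiverAlgebra ρ') := .of_split s t hts
  have : Module.Finite (QuiverAlgebra ρ) (QuiverAlgebra ρ') :=
    .of_surjective t fun b => ⟨s b, LinearMap.congr_fun hts b⟩
  have : Module.Finite K (QuiverAlgebra ρ') := .trans (QuiverAlgebra ρ) _
  have := QuiverAlgebra.isSemisimpleRing_quotient_jacobson hρ
  have := QuiverAlgebra.isSemisimpleRing_quotient_jacobson hρ'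
  have : IsNoetherianRing (QuiverAlgebra ρ') := isNoetherian_of_tower K inferInstance
  refine QuiverAlgebra.isKoszul_lengthGrading hρ'
    -- What is left is `J(B) = J(A)B`. A path of positive length in `Q'` is its image acting on a
    -- trivial path; conversely lifts of paths of positive length have positive length.
    (extOnePow_eq_top_of_restrictScalars (A := QuiverAlgebra ρ) (fun b => ?_) h)
  constructor
  · intro hb
    rw [QuiverAlgebra.mem_jacobson_iff hρ'] at hb
    have hpath : ∀ p : QuiverPath V', 1 ≤ p.length → QuiverAlgebra.ofPath ρ' p ∈
        (Ring.jacobson (QuiverAlgebra ρ) • ⊤ :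
          Submodule (QuiverAlgebra ρ) (QuiverAlgebra ρ')) := by
      intro p hp
      have hp' : QuiverAlgebra.ofPath ρ' p = QuiverAlgebra.ofPath ρ (p.map F) • e p.source :=
        (hF.pullback_map_mul_trivial hsurj p).symm
      rw [hp']
      refine Submodule.smul_mem_smul (M := QuiverAlgebra ρ') ?_ Submodule.mem_top
      rw [QuiverAlgebra.mem_jacobson_iff hρ]
      exact QuiverAlgebra.ofPath_mem_lengthGE (by rwa [QuiverPath.length_map])
    have hle : QuiverAlgebra.lengthGE ρ' 1 ≤ (Ring.jacobson (QuiverAlgebra ρ) • ⊤ :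
        Submodule (QuiverAlgebra ρ) (QuiverAlgebra ρ')).restrictScalars K :=
      QuiverAlgebra.lengthGE_le hpath
    exact hle hb
  · intro hb
    refine Submodule.smul_induction_on hb (fun a ha b _ => ?_) fun b c => add_mem
    rw [QuiverAlgebra.mem_jacobson_iff hρ] at ha
    have := (QuiverAlgebra.mem_jacobson_iff hρ').2 (hF.pullback_mem_lengthGE hsurj ha)
    exact Ideal.mul_mem_right b _ this

end IsGaloisCovering

end GaloisCovering

end

theorem theorem4 {K : Type*} [Field K] {V : Type*} [Quiver V] [Finite V]
    {V' : Type*} [Quiver V']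
    (ρ : Set (PathAlgebra K V)) (ρ' : Set (PathAlgebra K V')) (F : V' ⥤q V)
    (hfin : Module.Finite K (QuiverAlgebra ρ))
    (hconn : IsConnectedAlgebra (QuiverAlgebra ρ))
    (hquad : IsQuadraticRelations ρ)
    (hKoszul : IsKoszul (lengthGrading ρ))
    (hF : IsGaloisCovering F ρ' ρ)
    (hG : Finite (CoveringAut F))
    (hchar : ¬ ringChar K ∣ Nat.card (CoveringAut F)) :
    ∃ _ : Finite V', IsKoszul (lengthGrading ρ') := by
  have hfinV' : Finite V' := hF.regular.finite_total
  have := hF.regular.connected.1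
  have := Fintype.ofFinite V
  have := Fintype.ofFinite V'
  exact ⟨hfinV', hF.isKoszul_lengthGrading hquad (hF.regular.covering.obj_surjective hquad hconn)
    hKoszul.quasiKoszul.generated⟩
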